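/- Let $n\ge 4$. For $i\ge 1$ let $p_i=\frac1n\sum_{j=1}^n X_j^i\in\mathbb R[X_1,\dots,X_n]$ be the $i$-th power mean, and for $\lambda=(\lambda_1,\dots,\lambda_l)$ write $p_\lambda=p_{\lambda_1}\cdots p_{\lambda_l}$; for instance $p_{(2^4)}=p_2^4$ and $p_{(4,2^2)}=p_4p_2^2$. Let $B_n$ be the hyperoctahedral group, acting by sign changes and permutations of the variables, let $H_{n,8}^{B_n}$ be the space of $B_n$-invariant (even symmetric) real forms of degree $8$ in $n$ variables, and let $\Sigma_{n,8}^{B_n}\subset H_{n,8}^{B_n}$ be the cone of those that are sums of squares of real polynomials. Define the matrix polynomials \begin{align*} B^{((n),\emptyset)}&=\begin{pmatrix}p_{(4^2)}&p_{(4,2^2)}\\p_{(4,2^2)}&p_{(2^4)}\end{pmatrix},\\ B^{((n-1,1),\emptyset)}&=\begin{pmatrix}p_{(4,2^2)}-p_{(2^4)}&p_{(6,2)}-p_{(4,2^2)}\\p_{(6,2)}-p_{(4,2^2)}&p_{(8)}-p_{(4^2)}\end{pmatrix},\\ B^{((n-2,2),\emptyset)}&=\left(\tfrac{-n+1}{n^2}p_{(8)}+\tfrac{4n-4}{n^2}p_{(6,2)}+\tfrac{n^2-3n+3}{n^2}p_{(4^2)}-2p_{(4,2^2)}+p_{(2^4)}\right),\\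 B^{((n-2),(2))}&=\begin{pmatrix}p_{(2^4)}-\frac1np_{(4,2^2)}&2p_{(4,2^2)}-\frac2np_{(6,2)}\\2p_{(4,2^2)}-\frac2np_{(6,2)}&2p_{(6,2)}+2p_{(4^2)}-\frac4np_{(8)}\end{pmatrix},\\ B^{((n-2),(1,1))}&=\left(p_{(6,2)}-p_{(4^2)}\right),\\ B^{((n-4),(4))}&=\left(p_{(2^4)}-\tfrac6np_{(4,2^2)}+\tfrac3{n^2}p_{(4^2)}+\tfrac8{n^2}p_{(6,2)}-\tfrac6{n^3}p_{(8)}\right),\\ B^{((n-3,1),(2))}&=\left(\tfrac2{n^2}p_{(8)}-\tfrac{2n+2}{n^2}p_{(6,2)}-\tfrac1np_{(4^2)}+\tfrac{n+3}np_{(4,2^2)}-p_{(2^4)}\right). \end{align*} Then an even symmetric octic $f\in H_{n,8}^{B_n}$ is a sum of squares if and only if there exist real symmetric positive semidefinite matrices $A^\Lambda$, one for each of the seven labels $\Lambda$ above and of the same size as $B^\Lambda$ (that is, $2\times2$ for $\Lambda=((n),\emptyset),\,((n-1,1),\emptyset),\,((n-2),(2))$ and $1\times1$ for $\Lambda=((n-2,2),\emptyset),\,((n-2),(1,1)),\,((n-4),(4)),\,((n-3,1),(2))$),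 such that $$f=\sum_{\Lambda}\operatorname{Tr}\left(A^\Lambda B^\Lambda\right).$$ Consequently, for every $n\ge4$, $\Sigma_{n,8}^{B_n}$ is exactly the set of all polynomials $\sum_\Lambda\operatorname{Tr}(A^\Lambda B^\Lambda)$ with all $A^\Lambda$ positive semidefinite of these sizes. -/

import Mathlib

open MvPolynomial

noncomputable section

namespace EvenSymmetric

/-- The linear substitution `X_i ↦ ε_i X_{σ(i)}` on `ℝ[X_1, …, X_n]`. As `σ` runs through the
permutations and `ε` through the sign vectors, these are the actions of all elements of the
hyperoctahedral group `B_n` (sign changes and permutations of the coordinates). -/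
def signedPerm {n : ℕ} (σ : Equiv.Perm (Fin n)) (ε : Fin n → ℤˣ) :
    MvPolynomial (Fin n) ℝ →ₐ[ℝ] MvPolynomial (Fin n) ℝ :=
  aeval fun i => C (((ε i : ℤˣ) : ℤ) : ℝ) * X (σ i)

/-- `H_{n,d}^{B_n}`: the space of even symmetric (that is, `B_n`-invariant) real forms of degree
`d` in `n` variables. -/
def invariantForms (n d : ℕ) : Submodule ℝ (MvPolynomial (Fin n) ℝ) where
  carrier := {f | f.IsHomogeneous d ∧ ∀ σ ε, signedPerm σ ε f = f}
  zero_mem' := ⟨isHomogeneous_zero _ _ _, fun _ _ => map_zero _⟩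
  add_mem' := by
    rintro f g ⟨hf, hf'⟩ ⟨hg, hg'⟩
    exact ⟨hf.add hg, fun σ ε => by rw [map_add, hf', hg']⟩
  smul_mem' := by
    rintro c f ⟨hf, hf'⟩
    exact ⟨(homogeneousSubmodule (Fin n) ℝ d).smul_mem c hf,
      fun σ ε => by rw [map_smul, hf']⟩

/-- `Σ_{n,d}`: the real forms of degree `d` in `n` variables that are sums of squares of
polynomials. -/
def sosForms (n d : ℕ) : Set (MvPolynomial (Fin n) ℝ) :=
  {f | f.IsHomogeneous d ∧ IsSumSq f}

/-- `Σ_{n,d}^{B_n}`: the even symmetric forms of degree `d` that are sums of squares. -/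
def invariantSosForms (n d : ℕ) : Set (MvPolynomial (Fin n) ℝ) :=
  sosForms n d ∩ invariantForms n d

/-- The power mean `(1/n) ∑_j X_j ^ i`. -/
def powerMean (n i : ℕ) : MvPolynomial (Fin n) ℝ :=
  ((n : ℝ)⁻¹) • ∑ j : Fin n, X j ^ i

/-- For `l = [l₁, …, l_k]`, the product `p_{l₁} ⋯ p_{l_k}` of power means in `n` variables. -/
def pm (n : ℕ) (l : List ℕ) : MvPolynomial (Fin n) ℝ :=
  (l.map (powerMean n)).prod

/-- The block of `((n), ∅)`. -/
def blockN (n : ℕ) : Matrix (Fin 2) (Fin 2) (MvPolynomial (Fin n) ℝ) :=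
  !![pm n [4, 4], pm n [4, 2, 2];
     pm n [4, 2, 2], pm n [2, 2, 2, 2]]

/-- The block of `((n-1, 1), ∅)`. -/
def blockN11 (n : ℕ) : Matrix (Fin 2) (Fin 2) (MvPolynomial (Fin n) ℝ) :=
  !![pm n [4, 2, 2] - pm n [2, 2, 2, 2], pm n [6, 2] - pm n [4, 2, 2];
     pm n [6, 2] - pm n [4, 2, 2], pm n [8] - pm n [4, 4]]

/-- The block of `((n-2, 2), ∅)`. -/
def blockN22 (n : ℕ) : Matrix (Fin 1) (Fin 1) (MvPolynomial (Fin n) ℝ) :=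
  !![((-(n : ℝ) + 1) / (n : ℝ) ^ 2) • pm n [8]
      + ((4 * (n : ℝ) - 4) / (n : ℝ) ^ 2) • pm n [6, 2]
      + (((n : ℝ) ^ 2 - 3 * (n : ℝ) + 3) / (n : ℝ) ^ 2) • pm n [4, 4]
      - (2 : ℝ) • pm n [4, 2, 2] + pm n [2, 2, 2, 2]]

/-- The block of `((n-2), (2))`. -/
def blockN2_2 (n : ℕ) : Matrix (Fin 2) (Fin 2) (MvPolynomial (Fin n) ℝ) :=
  !![pm n [2, 2, 2, 2] - (1 / (n : ℝ)) • pm n [4, 2, 2],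
      (2 : ℝ) • pm n [4, 2, 2] - (2 / (n : ℝ)) • pm n [6, 2];
     (2 : ℝ) • pm n [4, 2, 2] - (2 / (n : ℝ)) • pm n [6, 2],
      (2 : ℝ) • pm n [6, 2] + (2 : ℝ) • pm n [4, 4] - (4 / (n : ℝ)) • pm n [8]]

/-- The block of `((n-2), (1, 1))`. -/
def blockN2_11 (n : ℕ) : Matrix (Fin 1) (Fin 1) (MvPolynomial (Fin n) ℝ) :=
  !![pm n [6, 2] - pm n [4, 4]]

/-- The block of `((n-4), (4))`. -/
def blockN4_4 (n : ℕ) : Matrix (Fin 1) (Fin 1) (MvPolynomial (Fin n) ℝ) :=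
  !![pm n [2, 2, 2, 2] - (6 / (n : ℝ)) • pm n [4, 2, 2] + (3 / (n : ℝ) ^ 2) • pm n [4, 4]
      + (8 / (n : ℝ) ^ 2) • pm n [6, 2] - (6 / (n : ℝ) ^ 3) • pm n [8]]

/-- The block of `((n-3, 1), (2))`. -/
def blockN31_2 (n : ℕ) : Matrix (Fin 1) (Fin 1) (MvPolynomial (Fin n) ℝ) :=
  !![(2 / (n : ℝ) ^ 2) • pm n [8] - ((2 * (n : ℝ) + 2) / (n : ℝ) ^ 2) • pm n [6, 2]
      - (1 / (n : ℝ)) • pm n [4, 4] + (((n : ℝ) + 3) / (n : ℝ)) • pm n [4, 2, 2]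
      - pm n [2, 2, 2, 2]]

/-- `Tr (A B)` for a real matrix `A` and a matrix polynomial `B`. -/
def trMul {n k : ℕ} (A : Matrix (Fin k) (Fin k) ℝ)
    (B : Matrix (Fin k) (Fin k) (MvPolynomial (Fin n) ℝ)) : MvPolynomial (Fin n) ℝ :=
  (A.map C * B).trace

/-- `f` is a sum of the seven terms `Tr (A B)`, where `B` runs through the seven blocks and every
`A` is a real (symmetric) positive semidefinite matrix of the size of `B`. -/
def HasBlockRepresentation (n : ℕ) (f : MvPolynomial (Fin n) ℝ) : Prop :=
  ∃ (A₁ A₂ A₃ : Matrix (Fin 2) (Fin 2) ℝ) (A₄ A₅ A₆ A₇ : Matrix (Fin 1) (Fin 1) ℝ),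
    A₁.PosSemidef ∧ A₂.PosSemidef ∧ A₃.PosSemidef ∧
    A₄.PosSemidef ∧ A₅.PosSemidef ∧ A₆.PosSemidef ∧ A₇.PosSemidef ∧
    f = trMul A₁ (blockN n) + trMul A₂ (blockN11 n) + trMul A₄ (blockN22 n)
      + trMul A₃ (blockN2_2 n) + trMul A₅ (blockN2_11 n) + trMul A₆ (blockN4_4 n)
      + trMul A₇ (blockN31_2 n)

end EvenSymmetric

end

namespace EvenSymmetric

/-! The theorem is symmetry reduction for $B_n$, done by explicit averaging instead of
representation theory. Put $y_i=x_i^2$. The mean over all permutations of $y_{\sigma i}y_{\sigma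
j}y_{\sigma k}y_{\sigma l}$ depends only on which indices coincide, so for fixed $x$ it is described
by five numbers $c_0,\dots,c_4$ (`exists_orbitMean_eq`). The five products of power means of degree
eight are linear in these numbers (`eval_powerMeans`). Hence every identity between an averaged
square and the blocks becomes a rational identity in $n$ and the $c_i$.

Blocks give sums of squares because each block is a nonnegative multiple of a sum of rank one
matrices $vv^T$; writing $A$ as a sum of $ww^T$ turns the trace into a sum of squares
(`isSumSq_trMul`).

Conversely, let $f=\sum_k q_k^2$ be invariant. Each $q_k^2\le f$ pointwise, which forces $q_k$ to be
a quartic form (`degree_eq_of_sq_le`). Averaging over sign changes removes the products of monomials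
with different sets $S$ of odd exponents, and averaging over permutations follows
(`eval_eq_sum_permMean`). Since the degree is four, $S$ has 4, 2 or 0 elements, and a parity part is
$\prod_{i\in S}x_i$ times a constant, a linear form or a quadratic form in $y$. Splitting the
coefficients into their $S_n$-type components makes the averaged square an explicit nonnegative
combination of blocks: `isBlockFunction_quadruple`, `isBlockFunction_pair`,
`isBlockFunction_quadratic`. -/

/-! ### Permutation means of quartic monomials -/

/-- The mean over all permutations `σ` of `y_{σ i} y_{σ j} y_{σ k} y_{σ l}`. -/
noncomputable def orbitMean {n : ℕ} (y : Fin n → ℝ) (i j k l : Fin n) : ℝ :=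
  ((n.factorial : ℝ))⁻¹ * ∑ σ : Equiv.Perm (Fin n), y (σ i) * y (σ j) * y (σ k) * y (σ l)

lemma permMean_const {n : ℕ} (a : ℝ) :
    ((n.factorial : ℝ))⁻¹ * ∑ _σ : Equiv.Perm (Fin n), a = a := by
  have : (n.factorial : ℝ) ≠ 0 := by exact_mod_cast n.factorial_ne_zero
  simp [Finset.card_univ, Fintype.card_perm, this]

lemma orbitMean_comp {n : ℕ} (y : Fin n → ℝ) (τ : Equiv.Perm (Fin n)) (i j k l : Fin n) :
    orbitMean y (τ i) (τ j) (τ k) (τ l) = orbitMean y i j k l := by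
  unfold orbitMean
  congr 1
  exact Fintype.sum_equiv (Equiv.mulRight τ) _ _ fun σ => by simp

lemma orbitMean_swap₁ {n : ℕ} (y : Fin n → ℝ) (i j k l : Fin n) :
    orbitMean y i j k l = orbitMean y j i k l := by
  unfold orbitMean
  congr 1
  exact Finset.sum_congr rfl fun σ _ => by ring

lemma orbitMean_swap₂ {n : ℕ} (y : Fin n → ℝ) (i j k l : Fin n) :
    orbitMean y i j k l = orbitMean y i k j l := by
  unfold orbitMean
  congr 1
  exact Finset.sum_congr rfl fun σ _ => by ring

lemma orbitMean_swap₃ {n : ℕ} (y : Fin n → ℝ) (i j k l : Fin n) :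
    orbitMean y i j k l = orbitMean y i j l k := by
  unfold orbitMean
  congr 1
  exact Finset.sum_congr rfl fun σ _ => by ring

lemma exists_perm_four {n : ℕ} {a b : Fin 4 → Fin n} (ha : Function.Injective a)
    (hb : Function.Injective b) : ∃ τ : Equiv.Perm (Fin n), ∀ i, τ (a i) = b i := by
  have h := (Equiv.Perm.isMultiplyPretransitive (Fin n) 4).exists_smul_eq ⟨a, ha⟩ ⟨b, hb⟩
  obtain ⟨τ, hτ⟩ := h
  exact ⟨τ, fun i => by simpa using congrArg (fun e : Fin 4 ↪ Fin n => e i) hτ⟩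

lemma exists_perm_three {n : ℕ} {i j k i' j' k' : Fin n} (h₁ : i ≠ j) (h₂ : i ≠ k) (h₃ : j ≠ k)
    (h₁' : i' ≠ j') (h₂' : i' ≠ k') (h₃' : j' ≠ k') :
    ∃ τ : Equiv.Perm (Fin n), τ i = i' ∧ τ j = j' ∧ τ k = k' := by
  have ha : Function.Injective ![i, j, k] := by
    intro a b hab; fin_cases a <;> fin_cases b <;> simp_all
  have hb : Function.Injective ![i', j', k'] := by
    intro a b hab; fin_cases a <;> fin_cases b <;> simp_all
  obtain ⟨τ, hτ⟩ := (Equiv.Perm.isMultiplyPretransitive (Fin n) 3).exists_smul_eq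
    ⟨_, ha⟩ ⟨_, hb⟩
  have h := fun i => congrArg (fun e : Fin 3 ↪ Fin n => e i) hτ
  exact ⟨τ, by simpa using h 0, by simpa using h 1, by simpa using h 2⟩

lemma injective_vec_four {α : Type*} {i j k l : α} (h₁ : i ≠ j) (h₂ : i ≠ k) (h₃ : i ≠ l)
    (h₄ : j ≠ k) (h₅ : j ≠ l) (h₆ : k ≠ l) : Function.Injective ![i, j, k, l] := by
  intro a b hab; fin_cases a <;> fin_cases b <;> simp_all

/-- The orbit means are given by the parameters `c₀, …, c₄`, which weigh the possible coincidences
among the four indices. -/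
def HasOrbitParams {n : ℕ} (y : Fin n → ℝ) (c₀ c₁ c₂ c₃ c₄ : ℝ) : Prop :=
  ∀ i j k l, orbitMean y i j k l =
      c₀ + c₁ * ((if i = j then 1 else 0) + (if i = k then 1 else 0) + (if i = l then 1 else 0)
        + (if j = k then 1 else 0) + (if j = l then 1 else 0) + (if k = l then 1 else 0))
      + c₂ * ((if i = j then 1 else 0) * (if k = l then 1 else 0)
        + (if i = k then 1 else 0) * (if j = l then 1 else 0)
        + (if i = l then 1 else 0) * (if j = k then 1 else 0))
      + c₃ * ((if i = j then 1 else 0) * (if i = k then 1 else 0)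
        + (if i = j then 1 else 0) * (if i = l then 1 else 0)
        + (if i = k then 1 else 0) * (if i = l then 1 else 0)
        + (if j = k then 1 else 0) * (if j = l then 1 else 0))
      + c₄ * ((if i = j then 1 else 0) * ((if i = k then 1 else 0) * (if i = l then 1 else 0)))

/-- The mean of `y_{σ i} y_{σ j} y_{σ k} y_{σ l}` depends only on the coincidences among the four
indices. -/
theorem exists_orbitMean_eq {n : ℕ} (hn : 4 ≤ n) (y : Fin n → ℝ) :
    ∃ c₀ c₁ c₂ c₃ c₄ : ℝ, HasOrbitParams y c₀ c₁ c₂ c₃ c₄ := by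
  obtain ⟨m, rfl⟩ := Nat.exists_eq_add_of_le' hn
  let e : Fin 4 → Fin (m + 4) := fun i => Fin.castLE (by omega) i
  have he : Function.Injective e := Fin.castLE_injective _
  have ne : ∀ {i j : Fin 4}, i ≠ j → e i ≠ e j := fun h h' => h (he h')
  have e01 : e 0 ≠ e 1 := ne (by decide)
  have e02 : e 0 ≠ e 2 := ne (by decide)
  have e12 : e 1 ≠ e 2 := ne (by decide)
  set r := orbitMean y with hr
  have h1111 : ∀ i j k l, i ≠ j → i ≠ k → i ≠ l → j ≠ k → j ≠ l → k ≠ l →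
      r i j k l = r (e 0) (e 1) (e 2) (e 3) := by
    intro i j k l h₁ h₂ h₃ h₄ h₅ h₆
    obtain ⟨τ, hτ⟩ := exists_perm_four he (injective_vec_four h₁ h₂ h₃ h₄ h₅ h₆)
    rw [hr, ← orbitMean_comp y τ (e 0), hτ, hτ, hτ, hτ]; rfl
  have hP : ∀ i j k, i ≠ j → i ≠ k → j ≠ k → ∃ τ : Equiv.Perm (Fin (m + 4)),
      τ (e 0) = i ∧ τ (e 1) = j ∧ τ (e 2) = k := fun i j k h₁ h₂ h₃ =>
    exists_perm_three e01 e02 e12 h₁ h₂ h₃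
  -- A spare third index lets the patterns with only two distinct indices use transitivity on
  -- triples.
  have h3 : ∀ i j : Fin (m + 4), ∃ k, i ≠ k ∧ j ≠ k := by
    intro i j
    have : ({i, j} : Finset (Fin (m + 4))).card < Fintype.card (Fin (m + 4)) := by
      have := Finset.card_le_two (a := i) (b := j)
      simp only [Fintype.card_fin]; omega
    obtain ⟨k, hk⟩ := Finset.exists_mem_notMem_of_card_lt_card
      (s := {i, j}) (t := Finset.univ) (by simpa [Finset.card_univ] using this)
    simp only [Finset.mem_univ, Finset.mem_insert, Finset.mem_singleton, not_or, true_and] at hk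
    exact ⟨k, Ne.symm hk.1, Ne.symm hk.2⟩
  have h211 : ∀ i j k, i ≠ j → i ≠ k → j ≠ k → r i i j k = r (e 0) (e 0) (e 1) (e 2) := by
    intro i j k h₁ h₂ h₃
    obtain ⟨τ, rfl, rfl, rfl⟩ := hP i j k h₁ h₂ h₃
    exact orbitMean_comp y τ _ _ _ _
  have h22 : ∀ i j, i ≠ j → r i i j j = r (e 0) (e 0) (e 1) (e 1) := by
    intro i j h₁
    obtain ⟨k, h₂, h₃⟩ := h3 i j
    obtain ⟨τ, rfl, rfl, rfl⟩ := hP i j k h₁ h₂ h₃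
    exact orbitMean_comp y τ _ _ _ _
  have h31 : ∀ i j, i ≠ j → r i i i j = r (e 0) (e 0) (e 0) (e 1) := by
    intro i j h₁
    obtain ⟨k, h₂, h₃⟩ := h3 i j
    obtain ⟨τ, rfl, rfl, rfl⟩ := hP i j k h₁ h₂ h₃
    exact orbitMean_comp y τ _ _ _ _
  have h4 : ∀ i, r i i i i = r (e 0) (e 0) (e 0) (e 0) := by
    intro i
    rw [hr, ← orbitMean_comp y (Equiv.swap (e 0) i) (e 0)]
    simp
  have s₁ : ∀ i j k l, r i j k l = r j i k l := orbitMean_swap₁ y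
  have s₂ : ∀ i j k l, r i j k l = r i k j l := orbitMean_swap₂ y
  have s₃ : ∀ i j k l, r i j k l = r i j l k := orbitMean_swap₃ y
  clear_value r
  -- These solve a triangular system: the patterns 1111, 211, 22, 31 and 4 have means $c_0$,
  -- $c_0+c_1$, $c_0+2c_1+c_2$, $c_0+3c_1+c_3$ and $c_0+6c_1+3c_2+4c_3+c_4$.
  refine ⟨r (e 0) (e 1) (e 2) (e 3), r (e 0) (e 0) (e 1) (e 2) - r (e 0) (e 1) (e 2) (e 3),
    r (e 0) (e 0) (e 1) (e 1) - 2 * r (e 0) (e 0) (e 1) (e 2) + r (e 0) (e 1) (e 2) (e 3),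
    r (e 0) (e 0) (e 0) (e 1) - 3 * r (e 0) (e 0) (e 1) (e 2) + 2 * r (e 0) (e 1) (e 2) (e 3),
    r (e 0) (e 0) (e 0) (e 0) - 3 * r (e 0) (e 0) (e 1) (e 1) - 4 * r (e 0) (e 0) (e 0) (e 1)
      + 12 * r (e 0) (e 0) (e 1) (e 2) - 6 * r (e 0) (e 1) (e 2) (e 3), ?_⟩
  intro i j k l
  rw [← hr]
  by_cases hij : i = j
  · subst hij
    by_cases hik : i = k
    · subst hik
      by_cases hil : i = l
      · subst hil; rw [h4]; simp; ring
      · rw [h31 i l hil]; simp [hil]; ring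
    · by_cases hil : i = l
      · subst hil
        rw [s₃, h31 i k hik]; simp [hik, Ne.symm hik]; ring
      · by_cases hkl : k = l
        · subst hkl; rw [h22 i k hik]; simp [hik]; ring
        · rw [h211 i k l hik hil hkl]; simp [hik, hil, hkl]
  · by_cases hik : i = k
    · subst hik
      by_cases hil : i = l
      · subst hil; rw [s₂, s₃, h31 i j hij]; simp [hij, Ne.symm hij]; ring
      · by_cases hjl : j = l
        · subst hjl; rw [s₂, h22 i j hij]; simp [hij, Ne.symm hij]; ring
        · rw [s₂, h211 i j l hij hil hjl]; simp [hij, Ne.symm hij, hil, hjl]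
    · by_cases hil : i = l
      · subst hil
        by_cases hjk : j = k
        · subst hjk; rw [s₃, s₂, h22 i j hij]; simp [hij, Ne.symm hij]; ring
        · rw [s₃, s₂, h211 i j k hij hik hjk]; simp [hij, Ne.symm hij, hik, hjk, Ne.symm hik]
      · by_cases hjk : j = k
        · subst hjk
          by_cases hjl : j = l
          · subst hjl; rw [s₁, s₂, s₃, h31 j i (Ne.symm hij)]; simp [hij]; ring
          · rw [s₁, s₂, h211 j i l (Ne.symm hij) hjl hil]; simp [hij, hil, hjl]
        · by_cases hjl : j = l
          · subst hjl
            rw [s₁, s₃, s₂, h211 j i k (Ne.symm hij) hjk hik]; simp [hij, hik, hjk, Ne.symm hjk]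
          · by_cases hkl : k = l
            · subst hkl
              rw [s₂, s₁, s₃, s₂, h211 k i j (Ne.symm hik) (Ne.symm hjk) hij]
              simp [hij, hik, hjk]
            · rw [h1111 i j k l hij hik hil hjk hjl hkl]; simp [hij, hik, hil, hjk, hjl, hkl]

/-! ### Power means and one-dimensional blocks in the orbit parameters -/

lemma sum_orbitMean {n : ℕ} {ι : Type*} (s : Finset ι) (c : ι → ℝ) (i j k l : ι → Fin n)
    (y : Fin n → ℝ) :
    ∑ a ∈ s, c a * orbitMean y (i a) (j a) (k a) (l a) =
      ((n.factorial : ℝ))⁻¹ * ∑ σ : Equiv.Perm (Fin n),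
        ∑ a ∈ s, c a * (y (σ (i a)) * y (σ (j a)) * y (σ (k a)) * y (σ (l a))) := by
  unfold orbitMean
  simp only [Finset.mul_sum]
  rw [Finset.sum_comm]
  exact Finset.sum_congr rfl fun _ _ => Finset.sum_congr rfl fun _ _ => by ring

/-- Power sums are already symmetric, so averaging them changes nothing; this lets them be computed
from orbit means. -/
lemma sum_orbitMean_eq {n : ℕ} {ι : Type*} [Fintype ι] (i j k l : ι → Fin n) (y : Fin n → ℝ)
    (P : ℝ) (h : ∀ σ : Equiv.Perm (Fin n),
      ∑ a, y (σ (i a)) * y (σ (j a)) * y (σ (k a)) * y (σ (l a)) = P) :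
    ∑ a, orbitMean y (i a) (j a) (k a) (l a) = P := by
  have := sum_orbitMean Finset.univ (fun _ => 1) i j k l y
  simp only [one_mul, h, permMean_const] at this
  exact this

/-- The invariants of degree four in `y` in terms of the parameters that describe the orbit
means. -/
theorem powerSums_eq {n : ℕ} (y : Fin n → ℝ) {c₀ c₁ c₂ c₃ c₄ : ℝ}
    (h : HasOrbitParams y c₀ c₁ c₂ c₃ c₄) :
    (∑ i, y i ^ 4 = n * (c₀ + 6 * c₁ + 3 * c₂ + 4 * c₃ + c₄)) ∧
    ((∑ i, y i ^ 3) * ∑ i, y i = n ^ 2 * (c₀ + 3 * c₁ + c₃) + n * (3 * c₁ + 3 * c₂ + 3 * c₃ + c₄)) ∧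
    ((∑ i, y i ^ 2) * ∑ i, y i ^ 2 =
      n ^ 2 * (c₀ + 2 * c₁ + c₂) + n * (4 * c₁ + 2 * c₂ + 4 * c₃ + c₄)) ∧
    ((∑ i, y i ^ 2) * (∑ i, y i) * ∑ i, y i =
      n ^ 3 * (c₀ + c₁) + n ^ 2 * (5 * c₁ + c₂ + 2 * c₃) + n * (2 * c₂ + 2 * c₃ + c₄)) ∧
    ((∑ i, y i) * (∑ i, y i) * (∑ i, y i) * ∑ i, y i =
      n ^ 4 * c₀ + 6 * n ^ 3 * c₁ + n ^ 2 * (3 * c₂ + 4 * c₃) + n * c₄) := by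
  unfold HasOrbitParams at h
  have hs : ∀ (m : ℕ) (σ : Equiv.Perm (Fin n)), ∑ i, y (σ i) ^ m = ∑ i, y i ^ m := fun m σ =>
    Equiv.sum_comp σ fun i => y i ^ m
  have hs1 : ∀ (σ : Equiv.Perm (Fin n)), ∑ i, y (σ i) = ∑ i, y i := fun σ => Equiv.sum_comp σ y
  refine ⟨?_, ?_, ?_, ?_, ?_⟩
  · refine (sum_orbitMean_eq (fun i : Fin n => i) (fun i => i) (fun i => i) (fun i => i) y _ ?_).symm.trans ?_
    rotate_left
    · simp only [h]; simp; ring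
    · intro σ; rw [← hs 4 σ]; exact Finset.sum_congr rfl fun _ _ => by ring
  · refine (sum_orbitMean_eq (fun i : Fin n × Fin n => i.1) (fun i => i.1) (fun i => i.1)
      (fun i => i.2) y _ ?_).symm.trans ?_
    rotate_left
    · simp only [h, Fintype.sum_prod_type]
      simp [Finset.sum_add_distrib, ← Finset.mul_sum]; ring
    · intro σ
      rw [← hs 3 σ, ← hs1 σ, Finset.sum_mul_sum, Fintype.sum_prod_type]
      exact Finset.sum_congr rfl fun _ _ => Finset.sum_congr rfl fun _ _ => by ring
  · refine (sum_orbitMean_eq (fun i : Fin n × Fin n => i.1) (fun i => i.1) (fun i => i.2)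
      (fun i => i.2) y _ ?_).symm.trans ?_
    rotate_left
    · simp only [h, Fintype.sum_prod_type]
      simp [Finset.sum_add_distrib, ← Finset.mul_sum]; ring
    · intro σ
      rw [← hs 2 σ, Finset.sum_mul_sum, Fintype.sum_prod_type]
      exact Finset.sum_congr rfl fun _ _ => Finset.sum_congr rfl fun _ _ => by ring
  · refine (sum_orbitMean_eq (fun i : Fin n × Fin n × Fin n => i.1) (fun i => i.1) (fun i => i.2.1)
      (fun i => i.2.2) y _ ?_).symm.trans ?_
    rotate_left
    · simp only [h, Fintype.sum_prod_type]
      simp [Finset.sum_add_distrib, ← Finset.mul_sum, apply_ite Finset.card]; ring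
    · intro σ
      rw [← hs 2 σ, ← hs1 σ]
      simp only [Fintype.sum_prod_type, Finset.sum_mul, Finset.mul_sum]
      rw [Finset.sum_comm]
      refine Finset.sum_congr rfl fun _ _ => ?_
      rw [Finset.sum_comm]
      exact Finset.sum_congr rfl fun _ _ => Finset.sum_congr rfl fun _ _ => by ring
  · refine (sum_orbitMean_eq (fun i : Fin n × Fin n × Fin n × Fin n => i.1) (fun i => i.2.1)
      (fun i => i.2.2.1) (fun i => i.2.2.2) y _ ?_).symm.trans ?_
    rotate_left
    · simp only [h, Fintype.sum_prod_type]
      simp [Finset.sum_add_distrib, ← Finset.mul_sum, apply_ite Finset.card]; ring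
    · intro σ
      rw [← hs1 σ]
      simp only [Fintype.sum_prod_type, ← Finset.mul_sum, ← Finset.sum_mul]

lemma eval_powerMean (n m : ℕ) (x : Fin n → ℝ) :
    eval x (powerMean n m) = (n : ℝ)⁻¹ * ∑ j, x j ^ m := by
  simp [powerMean, smul_eval]

/-- The products of power means of total degree eight in terms of the orbit parameters of the
squares of the coordinates. -/
theorem eval_powerMeans {n : ℕ} (hn : 4 ≤ n) (x : Fin n → ℝ) {c₀ c₁ c₂ c₃ c₄ : ℝ}
    (h : HasOrbitParams (fun i => x i ^ 2) c₀ c₁ c₂ c₃ c₄) :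
    eval x (pm n [8]) = c₀ + 6 * c₁ + 3 * c₂ + 4 * c₃ + c₄ ∧
    eval x (pm n [6, 2]) = c₀ + 3 * c₁ + c₃ + (3 * c₁ + 3 * c₂ + 3 * c₃ + c₄) / n ∧
    eval x (pm n [4, 4]) = c₀ + 2 * c₁ + c₂ + (4 * c₁ + 2 * c₂ + 4 * c₃ + c₄) / n ∧
    eval x (pm n [4, 2, 2]) = c₀ + c₁ + (5 * c₁ + c₂ + 2 * c₃) / n
      + (2 * c₂ + 2 * c₃ + c₄) / (n : ℝ) ^ 2 ∧
    eval x (pm n [2, 2, 2, 2]) = c₀ + 6 * c₁ / n + (3 * c₂ + 4 * c₃) / (n : ℝ) ^ 2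
      + c₄ / (n : ℝ) ^ 3 := by
  have hn0 : (n : ℝ) ≠ 0 := by
    have : n ≠ 0 := by omega
    exact_mod_cast this
  obtain ⟨h8, h62, h44, h422, h2222⟩ := powerSums_eq _ h
  simp only [← pow_mul, Nat.reduceMul] at h8 h62 h44 h422 h2222
  simp only [pm, List.map_cons, List.map_nil, List.prod_cons, List.prod_nil, mul_one, map_mul,
    eval_powerMean]
  refine ⟨?_, ?_, ?_, ?_, ?_⟩
  · rw [h8]; field_simp
  · field_simp; linear_combination h62
  · field_simp; linear_combination h44
  · field_simp; linear_combination h422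
  · field_simp; linear_combination h2222

lemma cast_ne_zero_of_four_le {n : ℕ} (hn : 4 ≤ n) : (n : ℝ) ≠ 0 := by
  have : n ≠ 0 := by omega
  exact_mod_cast this

/-- This block, `blockN4_4` and `blockN31_2` each isolate one parameter. With $y_i=x_i^2$, $c_2$ is
a quarter of the mean of $((y_1-y_2)(y_3-y_4))^2$, $c_0$ is the mean of $y_1y_2y_3y_4$, and $c_1$ is
half the mean of $y_1y_2(y_3-y_4)^2$. The common factor is the proportion of index quadruples with
distinct entries. -/
lemma eval_blockN22 {n : ℕ} (hn : 4 ≤ n) (x : Fin n → ℝ) {c₀ c₁ c₂ c₃ c₄ : ℝ}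
    (h : HasOrbitParams (fun i => x i ^ 2) c₀ c₁ c₂ c₃ c₄) : eval x (blockN22 n 0 0) =
      ((n : ℝ) - 1) * (n - 2) * (n - 3) / (n : ℝ) ^ 3 * c₂ := by
  have hn0 := cast_ne_zero_of_four_le hn
  obtain ⟨h8, h62, h44, h422, h2222⟩ := eval_powerMeans hn x h
  simp only [blockN22, Matrix.of_apply, Matrix.cons_val_zero, map_add, map_sub, smul_eval, h8,
    h62, h44, h422, h2222]
  field_simp
  ring

lemma eval_blockN4_4 {n : ℕ} (hn : 4 ≤ n) (x : Fin n → ℝ) {c₀ c₁ c₂ c₃ c₄ : ℝ}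
    (h : HasOrbitParams (fun i => x i ^ 2) c₀ c₁ c₂ c₃ c₄) : eval x (blockN4_4 n 0 0) =
      ((n : ℝ) - 1) * (n - 2) * (n - 3) / (n : ℝ) ^ 3 * c₀ := by
  have hn0 := cast_ne_zero_of_four_le hn
  obtain ⟨h8, h62, h44, h422, h2222⟩ := eval_powerMeans hn x h
  simp only [blockN4_4, Matrix.of_apply, Matrix.cons_val_zero, map_add, map_sub, smul_eval, h8,
    h62, h44, h422, h2222]
  field_simp
  ring

lemma eval_blockN31_2 {n : ℕ} (hn : 4 ≤ n) (x : Fin n → ℝ) {c₀ c₁ c₂ c₃ c₄ : ℝ}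
    (h : HasOrbitParams (fun i => x i ^ 2) c₀ c₁ c₂ c₃ c₄) : eval x (blockN31_2 n 0 0) =
      ((n : ℝ) - 1) * (n - 2) * (n - 3) / (n : ℝ) ^ 3 * c₁ := by
  have hn0 := cast_ne_zero_of_four_le hn
  obtain ⟨h8, h62, h44, h422, h2222⟩ := eval_powerMeans hn x h
  simp only [blockN31_2, Matrix.of_apply, Matrix.cons_val_zero, map_add, map_sub, smul_eval, h8,
    h62, h44, h422, h2222]
  field_simp
  ring

/-! ### Each block yields sums of squares -/

lemma isSumSq_C {n : ℕ} {κ : ℝ} (h : 0 ≤ κ) : IsSumSq (C κ : MvPolynomial (Fin n) ℝ) := by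
  rw [← Real.mul_self_sqrt h, C_mul]
  exact IsSumSq.mul_self _

/-- The trace of the product of a positive semidefinite matrix and a nonnegative combination of
rank one matrices is a sum of squares. -/
theorem isSumSq_trMul {n k : ℕ} {ι : Type*} [Fintype ι] {A : Matrix (Fin k) (Fin k) ℝ}
    (hA : A.PosSemidef) {κ : ℝ} (hκ : 0 ≤ κ) (v : ι → Fin k → MvPolynomial (Fin n) ℝ)
    {B : Matrix (Fin k) (Fin k) (MvPolynomial (Fin n) ℝ)}
    (hB : ∀ i j, B i j = C κ * ∑ m, v m i * v m j) : IsSumSq (trMul A B) := by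
  obtain ⟨r, w, hw⟩ := Matrix.posSemidef_iff_eq_sum_vecMulVec.mp hA
  have hA' : ∀ i j, A i j = ∑ l, w l i * w l j := fun i j => by
    simp [hw, Matrix.sum_apply, Matrix.vecMulVec_apply]
  have key : trMul A B = C κ * ∑ m, ∑ l, (∑ i, C (w l i) * v m i) * ∑ i, C (w l i) * v m i := by
    calc trMul A B = ∑ i, ∑ j, ∑ m, ∑ l,
          C κ * ((C (w l i) * v m i) * (C (w l j) * v m j)) := by
          simp only [trMul, Matrix.trace, Matrix.diag, Matrix.mul_apply, Matrix.map_apply]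
          refine Finset.sum_congr rfl fun i _ => Finset.sum_congr rfl fun j _ => ?_
          rw [hA', hB, map_sum, Finset.sum_mul, Finset.sum_comm]
          refine Finset.sum_congr rfl fun l _ => ?_
          rw [Finset.mul_sum, Finset.mul_sum]
          refine Finset.sum_congr rfl fun m _ => ?_
          rw [map_mul]
          ring
      _ = ∑ m, ∑ l, ∑ i, ∑ j, C κ * ((C (w l i) * v m i) * (C (w l j) * v m j)) := by
          rw [Finset.sum_congr rfl fun i _ => Finset.sum_comm, Finset.sum_comm]
          refine Finset.sum_congr rfl fun m _ => ?_
          rw [Finset.sum_congr rfl fun i _ => Finset.sum_comm, Finset.sum_comm]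
      _ = _ := by
          simp only [Finset.mul_sum, Finset.sum_mul]
          refine Finset.sum_congr rfl fun m _ => Finset.sum_congr rfl fun l _ => ?_
          rw [Finset.sum_comm]
  rw [key]
  refine (isSumSq_C hκ).mul ?_
  exact IsSumSq.sum fun m _ => IsSumSq.sum fun l _ => IsSumSq.mul_self _

lemma isSumSq_trMul_blockN (n : ℕ) {A : Matrix (Fin 2) (Fin 2) ℝ} (hA : A.PosSemidef) :
    IsSumSq (trMul A (blockN n)) := by
  refine isSumSq_trMul hA zero_le_one (fun _ : Unit => ![pm n [4], pm n [2, 2]]) fun i j => ?_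
  fin_cases i <;> fin_cases j <;> simp [blockN, pm] <;> ring

lemma isSumSq_trMul_blockN11 {n : ℕ} (hn : 4 ≤ n) {A : Matrix (Fin 2) (Fin 2) ℝ}
    (hA : A.PosSemidef) : IsSumSq (trMul A (blockN11 n)) := by
  have hn0 := cast_ne_zero_of_four_le hn
  -- The block is the covariance matrix of $p_2X_m^2$ and $X_m^4$ as $m$ varies.
  refine isSumSq_trMul hA (κ := (n : ℝ)⁻¹) (by positivity) (fun m : Fin n =>
    ![powerMean n 2 * (X m ^ 2 - powerMean n 2), X m ^ 4 - powerMean n 4]) fun i j => ?_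
  apply MvPolynomial.funext
  intro x
  have e : ∀ a b c d : ℝ, ∑ m, (a * (x m ^ 2 - b)) * (c * (x m ^ 2 - d)) =
      a * c * (∑ m, x m ^ 4 - (b + d) * ∑ m, x m ^ 2 + n * b * d) := by
    intro a b c d
    have : ∀ m, (a * (x m ^ 2 - b)) * (c * (x m ^ 2 - d)) =
      a * c * (x m ^ 4 - (b + d) * x m ^ 2 + b * d) := fun m => by ring
    simp only [this, ← Finset.mul_sum, Finset.sum_add_distrib, Finset.sum_sub_distrib]
    simp only [Finset.sum_const, Finset.card_univ, Fintype.card_fin, nsmul_eq_mul]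
    ring
  have e' : ∀ a b d : ℝ, ∑ m, (a * (x m ^ 2 - b)) * (x m ^ 4 - d) =
      a * (∑ m, x m ^ 6 - b * ∑ m, x m ^ 4 - d * ∑ m, x m ^ 2 + n * b * d) := by
    intro a b d
    have : ∀ m, (a * (x m ^ 2 - b)) * (x m ^ 4 - d) =
      a * (x m ^ 6 - b * x m ^ 4 - d * x m ^ 2 + b * d) := fun m => by ring
    simp only [this, ← Finset.mul_sum, Finset.sum_add_distrib, Finset.sum_sub_distrib]
    simp only [Finset.sum_const, Finset.card_univ, Fintype.card_fin, nsmul_eq_mul]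
    ring
  have e'' : ∀ b d : ℝ, ∑ m, (x m ^ 4 - b) * (x m ^ 4 - d) =
      ∑ m, x m ^ 8 - (b + d) * ∑ m, x m ^ 4 + n * b * d := by
    intro b d
    have : ∀ m, (x m ^ 4 - b) * (x m ^ 4 - d) =
      x m ^ 8 - (b + d) * x m ^ 4 + b * d := fun m => by ring
    simp only [this, ← Finset.mul_sum, Finset.sum_add_distrib, Finset.sum_sub_distrib]
    simp only [Finset.sum_const, Finset.card_univ, Fintype.card_fin, nsmul_eq_mul]
    ring
  fin_cases i <;> fin_cases j <;>
    simp [blockN11, pm, eval_powerMean, e, e', e'', mul_comm (_ - _) (_ * (_ - _))] <;>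
    field_simp <;> ring

lemma sum_offDiag {ι : Type*} [Fintype ι] [DecidableEq ι] (F : ι → ι → ℝ) :
    ∑ p : ι × ι, (if p.1 = p.2 then 0 else F p.1 p.2) = ∑ i, ∑ j, F i j - ∑ i, F i i := by
  rw [Fintype.sum_prod_type, ← Finset.sum_sub_distrib]
  refine Finset.sum_congr rfl fun i _ => ?_
  have h : ∀ j, (if i = j then 0 else F i j) = F i j - if i = j then F i j else 0 := fun j => by
    split_ifs <;> simp
  simp [h, Finset.sum_sub_distrib]

lemma isSumSq_trMul_blockN2_2 {n : ℕ} (hn : 4 ≤ n) {A : Matrix (Fin 2) (Fin 2) ℝ}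
    (hA : A.PosSemidef) : IsSumSq (trMul A (blockN2_2 n)) := by
  have hn0 := cast_ne_zero_of_four_le hn
  refine isSumSq_trMul hA (κ := ((n : ℝ) ^ 2)⁻¹) (by positivity) (fun p : Fin n × Fin n =>
    if p.1 = p.2 then 0 else
      ![X p.1 * X p.2 * powerMean n 2, X p.1 * X p.2 * (X p.1 ^ 2 + X p.2 ^ 2)]) fun i j => ?_
  apply MvPolynomial.funext
  intro x
  have e : ∀ (a b : Fin n → Fin n → ℝ), (∑ p : Fin n × Fin n,
      (if p.1 = p.2 then 0 else a p.1 p.2) * (if p.1 = p.2 then 0 else b p.1 p.2)) =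
      ∑ i, ∑ j, a i j * b i j - ∑ i, a i i * b i i := by
    intro a b
    rw [← sum_offDiag fun i j => a i j * b i j]
    exact Finset.sum_congr rfl fun p _ => by split_ifs <;> simp
  have e11 : ∀ a : ℝ, ∑ p : Fin n × Fin n, (if p.1 = p.2 then 0 else x p.1 * x p.2 * a) *
      (if p.1 = p.2 then 0 else x p.1 * x p.2 * a) =
      a ^ 2 * ((∑ i, x i ^ 2) * (∑ i, x i ^ 2) - ∑ i, x i ^ 4) := by
    intro a
    rw [e (fun i j => x i * x j * a) fun i j => x i * x j * a]
    simp only [Finset.sum_mul_sum]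
    simp only [mul_sub, Finset.mul_sum]
    congr 1
    · exact Finset.sum_congr rfl fun _ _ => Finset.sum_congr rfl fun _ _ => by ring
    · exact Finset.sum_congr rfl fun _ _ => by ring
  have e12 : ∀ a : ℝ, ∑ p : Fin n × Fin n, (if p.1 = p.2 then 0 else x p.1 * x p.2 * a) *
      (if p.1 = p.2 then 0 else x p.1 * x p.2 * (x p.1 ^ 2 + x p.2 ^ 2)) =
      a * ((∑ i, x i ^ 4) * (∑ i, x i ^ 2) + (∑ i, x i ^ 2) * (∑ i, x i ^ 4)
        - 2 * ∑ i, x i ^ 6) := by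
    intro a
    rw [e (fun i j => x i * x j * a) fun i j => x i * x j * (x i ^ 2 + x j ^ 2)]
    simp only [Finset.sum_mul_sum]
    simp only [mul_sub, Finset.mul_sum, ← Finset.sum_add_distrib]
    congr 1
    · exact Finset.sum_congr rfl fun _ _ => Finset.sum_congr rfl fun _ _ => by ring
    · exact Finset.sum_congr rfl fun _ _ => by ring
  have e22 : ∑ p : Fin n × Fin n,
      (if p.1 = p.2 then 0 else x p.1 * x p.2 * (x p.1 ^ 2 + x p.2 ^ 2)) *
      (if p.1 = p.2 then 0 else x p.1 * x p.2 * (x p.1 ^ 2 + x p.2 ^ 2)) =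
      (∑ i, x i ^ 6) * (∑ i, x i ^ 2) + 2 * ((∑ i, x i ^ 4) * (∑ i, x i ^ 4))
        + (∑ i, x i ^ 2) * (∑ i, x i ^ 6) - 4 * ∑ i, x i ^ 8 := by
    rw [e (fun i j => x i * x j * (x i ^ 2 + x j ^ 2)) fun i j => x i * x j * (x i ^ 2 + x j ^ 2)]
    simp only [Finset.sum_mul_sum]
    simp only [Finset.mul_sum, ← Finset.sum_add_distrib]
    congr 1
    · exact Finset.sum_congr rfl fun _ _ => Finset.sum_congr rfl fun _ _ => by ring
    · exact Finset.sum_congr rfl fun _ _ => by ring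
  have e21 := fun a => (Finset.sum_congr rfl fun _ _ => mul_comm _ _).trans (e12 a)
  fin_cases i <;> fin_cases j <;>
    simp [blockN2_2, pm, eval_powerMean, smul_eval, apply_ite (eval x),
      ite_apply, -mul_eq_zero, -zero_eq_mul, -mul_ite, -ite_mul, e11, e12, e21, e22] <;>
    field_simp <;> ring

lemma isSumSq_trMul_blockN2_11 {n : ℕ} (hn : 4 ≤ n) {A : Matrix (Fin 1) (Fin 1) ℝ}
    (hA : A.PosSemidef) : IsSumSq (trMul A (blockN2_11 n)) := by
  have hn0 := cast_ne_zero_of_four_le hn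
  -- Diagonal pairs contribute zero, so the sum may run over all ordered pairs; each unordered pair
  -- counts twice.
  refine isSumSq_trMul hA (κ := (2 * (n : ℝ) ^ 2)⁻¹) (by positivity) (fun p : Fin n × Fin n =>
    fun _ => X p.1 * X p.2 * (X p.1 ^ 2 - X p.2 ^ 2)) fun i j => ?_
  apply MvPolynomial.funext
  intro x
  have e : ∑ p : Fin n × Fin n, x p.1 * x p.2 * (x p.1 ^ 2 - x p.2 ^ 2) *
      (x p.1 * x p.2 * (x p.1 ^ 2 - x p.2 ^ 2)) =
      (∑ i, x i ^ 6) * (∑ i, x i ^ 2) - 2 * ((∑ i, x i ^ 4) * (∑ i, x i ^ 4))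
        + (∑ i, x i ^ 2) * (∑ i, x i ^ 6) := by
    simp only [Finset.sum_mul_sum]
    simp only [Finset.mul_sum, ← Finset.sum_add_distrib,
      ← Finset.sum_sub_distrib, Fintype.sum_prod_type]
    exact Finset.sum_congr rfl fun _ _ => Finset.sum_congr rfl fun _ _ => by ring
  fin_cases i
  fin_cases j
  simp [blockN2_11, pm, eval_powerMean, e]
  field_simp
  ring

lemma blockCoeff_pos {n : ℕ} (hn : 4 ≤ n) :
    0 < ((n : ℝ) - 1) * (n - 2) * (n - 3) / (n : ℝ) ^ 3 := by
  have : (4 : ℝ) ≤ n := by exact_mod_cast hn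
  have h1 : 0 < (n : ℝ) - 1 := by linarith
  have h2 : 0 < (n : ℝ) - 2 := by linarith
  have h3 : 0 < (n : ℝ) - 3 := by linarith
  positivity

lemma isSumSq_trMul_blockN22 {n : ℕ} (hn : 4 ≤ n) {A : Matrix (Fin 1) (Fin 1) ℝ}
    (hA : A.PosSemidef) : IsSumSq (trMul A (blockN22 n)) := by
  have hK := blockCoeff_pos hn
  let e : Fin 4 → Fin n := Fin.castLE hn
  have ne : ∀ {i j : Fin 4}, e i = e j ↔ i = j := (Fin.castLE_injective hn).eq_iff
  refine isSumSq_trMul hA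
    (κ := ((n : ℝ) - 1) * (n - 2) * (n - 3) / (n : ℝ) ^ 3 / 4 * (n.factorial : ℝ)⁻¹)
    (by positivity) (fun (σ : Equiv.Perm (Fin n)) _ =>
      (X (σ (e 0)) ^ 2 - X (σ (e 1)) ^ 2) * (X (σ (e 2)) ^ 2 - X (σ (e 3)) ^ 2)) fun i j => ?_
  apply MvPolynomial.funext
  intro x
  obtain ⟨c₀, c₁, c₂, c₃, c₄, h⟩ := exists_orbitMean_eq hn fun i => x i ^ 2
  rw [Subsingleton.elim i 0, Subsingleton.elim j 0, eval_blockN22 hn x h]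
  generalize ((n : ℝ) - 1) * (n - 2) * (n - 3) / (n : ℝ) ^ 3 = K
  -- The sixteen values of `m` enumerate the signed monomials in the expansion of
  -- $(y_0-y_1)^2(y_2-y_3)^2$.
  have hr := sum_orbitMean Finset.univ
    (fun m : Fin 2 × Fin 2 × Fin 2 × Fin 2 =>
      (-1 : ℝ) ^ (m.1.1 + m.2.1.1 + m.2.2.1.1 + m.2.2.2.1))
    (fun m => e (![0, 1] m.1)) (fun m => e (![0, 1] m.2.1)) (fun m => e (![2, 3] m.2.2.1))
    (fun m => e (![2, 3] m.2.2.2)) fun i => x i ^ 2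
  have hl : ∑ m : Fin 2 × Fin 2 × Fin 2 × Fin 2,
      (-1 : ℝ) ^ (m.1.1 + m.2.1.1 + m.2.2.1.1 + m.2.2.2.1) *
        orbitMean (fun i => x i ^ 2) (e (![0, 1] m.1)) (e (![0, 1] m.2.1)) (e (![2, 3] m.2.2.1))
          (e (![2, 3] m.2.2.2)) = 4 * c₂ := by
    unfold HasOrbitParams at h
    simp [h, ne, Fintype.sum_prod_type, Fin.sum_univ_two]
    ring
  rw [hl] at hr
  simp only [map_mul, map_sum, map_sub, map_pow, eval_C, eval_X]
  rw [mul_assoc, show ∑ σ : Equiv.Perm (Fin n), _ = _ from Finset.sum_congr rfl fun σ _ => ?_, ← hr]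
  · ring
  · simp [Fintype.sum_prod_type, Fin.sum_univ_two]
    ring

lemma isSumSq_trMul_blockN4_4 {n : ℕ} (hn : 4 ≤ n) {A : Matrix (Fin 1) (Fin 1) ℝ}
    (hA : A.PosSemidef) : IsSumSq (trMul A (blockN4_4 n)) := by
  have hK := blockCoeff_pos hn
  let e : Fin 4 → Fin n := Fin.castLE hn
  have ne : ∀ {i j : Fin 4}, e i = e j ↔ i = j := (Fin.castLE_injective hn).eq_iff
  refine isSumSq_trMul hA
    (κ := ((n : ℝ) - 1) * (n - 2) * (n - 3) / (n : ℝ) ^ 3 * (n.factorial : ℝ)⁻¹)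
    (by positivity) (fun (σ : Equiv.Perm (Fin n)) _ =>
      X (σ (e 0)) * X (σ (e 1)) * X (σ (e 2)) * X (σ (e 3))) fun i j => ?_
  apply MvPolynomial.funext
  intro x
  obtain ⟨c₀, c₁, c₂, c₃, c₄, h⟩ := exists_orbitMean_eq hn fun i => x i ^ 2
  rw [Subsingleton.elim i 0, Subsingleton.elim j 0, eval_blockN4_4 hn x h]
  have hr := h (e 0) (e 1) (e 2) (e 3)
  simp only [ne] at hr
  simp [orbitMean] at hr
  rw [← hr]
  simp only [map_mul, map_sum, eval_C, eval_X, mul_assoc]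
  congr 5
  exact funext fun σ => by ring

lemma isSumSq_trMul_blockN31_2 {n : ℕ} (hn : 4 ≤ n) {A : Matrix (Fin 1) (Fin 1) ℝ}
    (hA : A.PosSemidef) : IsSumSq (trMul A (blockN31_2 n)) := by
  have hK := blockCoeff_pos hn
  let e : Fin 4 → Fin n := Fin.castLE hn
  have ne : ∀ {i j : Fin 4}, e i = e j ↔ i = j := (Fin.castLE_injective hn).eq_iff
  refine isSumSq_trMul hA
    (κ := ((n : ℝ) - 1) * (n - 2) * (n - 3) / (n : ℝ) ^ 3 / 2 * (n.factorial : ℝ)⁻¹)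
    (by positivity) (fun (σ : Equiv.Perm (Fin n)) _ =>
      X (σ (e 0)) * X (σ (e 1)) * (X (σ (e 2)) ^ 2 - X (σ (e 3)) ^ 2)) fun i j => ?_
  apply MvPolynomial.funext
  intro x
  obtain ⟨c₀, c₁, c₂, c₃, c₄, h⟩ := exists_orbitMean_eq hn fun i => x i ^ 2
  rw [Subsingleton.elim i 0, Subsingleton.elim j 0, eval_blockN31_2 hn x h]
  generalize ((n : ℝ) - 1) * (n - 2) * (n - 3) / (n : ℝ) ^ 3 = K
  have hr := sum_orbitMean Finset.univ
    (fun m : Fin 2 × Fin 2 => (-1 : ℝ) ^ (m.1.1 + m.2.1))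
    (fun m => e 0) (fun m => e 1) (fun m => e (![2, 3] m.1))
    (fun m => e (![2, 3] m.2)) fun i => x i ^ 2
  have hl : ∑ m : Fin 2 × Fin 2, (-1 : ℝ) ^ (m.1.1 + m.2.1) *
        orbitMean (fun i => x i ^ 2) (e 0) (e 1) (e (![2, 3] m.1)) (e (![2, 3] m.2)) =
      2 * c₁ := by
    unfold HasOrbitParams at h
    simp [h, ne, Fintype.sum_prod_type, Fin.sum_univ_two]
    ring
  rw [hl] at hr
  simp only [map_mul, map_sum, map_sub, map_pow, eval_C, eval_X]
  rw [mul_assoc, show ∑ σ : Equiv.Perm (Fin n), _ = _ from Finset.sum_congr rfl fun σ _ => ?_, ← hr]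
  · ring
  · simp [Fintype.sum_prod_type, Fin.sum_univ_two]
    ring

/-- Every polynomial with a block representation is a sum of squares. -/
theorem HasBlockRepresentation.isSumSq {n : ℕ} (hn : 4 ≤ n) {f : MvPolynomial (Fin n) ℝ}
    (hf : HasBlockRepresentation n f) : IsSumSq f := by
  obtain ⟨A₁, A₂, A₃, A₄, A₅, A₆, A₇, h₁, h₂, h₃, h₄, h₅, h₆, h₇, rfl⟩ := hf
  exact ((((((isSumSq_trMul_blockN n h₁).add (isSumSq_trMul_blockN11 hn h₂)).add
    (isSumSq_trMul_blockN22 hn h₄)).add (isSumSq_trMul_blockN2_2 hn h₃)).add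
    (isSumSq_trMul_blockN2_11 hn h₅)).add (isSumSq_trMul_blockN4_4 hn h₆)).add
    (isSumSq_trMul_blockN31_2 hn h₇)

/-! ### Block representations are even symmetric octics -/

lemma isHomogeneous_pm (n : ℕ) (l : List ℕ) : (pm n l).IsHomogeneous l.sum := by
  induction l with
  | nil => simpa [pm] using isHomogeneous_one (Fin n) ℝ
  | cons a l ih =>
    have h : (powerMean n a).IsHomogeneous a :=
      (homogeneousSubmodule (Fin n) ℝ a).smul_mem _
        (IsHomogeneous.sum _ _ _ fun j _ => isHomogeneous_X_pow j a)
    simpa [pm] using h.mul ih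

lemma signedPerm_powerMean {n m : ℕ} (hm : Even m) (σ : Equiv.Perm (Fin n)) (ε : Fin n → ℤˣ) :
    signedPerm σ ε (powerMean n m) = powerMean n m := by
  have h : ∀ j, (C (((ε j : ℤˣ) : ℤ) : ℝ) * X (σ j) : MvPolynomial (Fin n) ℝ) ^ m
      = X (σ j) ^ m := by
    intro j
    rw [mul_pow, ← C_pow]
    rcases Int.units_eq_one_or (ε j) with h | h <;> simp [h, hm.neg_one_pow]
  simp only [powerMean, signedPerm, map_smul, map_sum, map_pow, aeval_X, h]
  rw [Equiv.sum_comp σ fun j => (X j : MvPolynomial (Fin n) ℝ) ^ m]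

lemma pm_mem_invariantForms (n : ℕ) {l : List ℕ} (hl : ∀ m ∈ l, Even m) :
    pm n l ∈ invariantForms n l.sum := by
  refine ⟨isHomogeneous_pm n l, fun σ ε => ?_⟩
  rw [pm, map_list_prod, List.map_map]
  congr 1
  exact List.map_congr_left fun m hm => signedPerm_powerMean (hl m hm) σ ε

lemma trMul_mem_invariantForms {n d k : ℕ} (A : Matrix (Fin k) (Fin k) ℝ)
    {B : Matrix (Fin k) (Fin k) (MvPolynomial (Fin n) ℝ)}
    (hB : ∀ i j, B i j ∈ invariantForms n d) : trMul A B ∈ invariantForms n d := by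
  simp only [trMul, Matrix.trace, Matrix.diag, Matrix.mul_apply, Matrix.map_apply, ← smul_eq_C_mul]
  exact sum_mem fun i _ => sum_mem fun j _ => Submodule.smul_mem _ _ (hB j i)

lemma blocks_mem {n : ℕ} {V : Submodule ℝ (MvPolynomial (Fin n) ℝ)} (h8 : pm n [8] ∈ V)
    (h62 : pm n [6, 2] ∈ V) (h44 : pm n [4, 4] ∈ V) (h422 : pm n [4, 2, 2] ∈ V)
    (h2222 : pm n [2, 2, 2, 2] ∈ V) :
    (∀ i j, blockN n i j ∈ V) ∧ (∀ i j, blockN11 n i j ∈ V) ∧ (∀ i j, blockN22 n i j ∈ V) ∧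
    (∀ i j, blockN2_2 n i j ∈ V) ∧ (∀ i j, blockN2_11 n i j ∈ V) ∧
    (∀ i j, blockN4_4 n i j ∈ V) ∧ (∀ i j, blockN31_2 n i j ∈ V) := by
  have hs : ∀ (c : ℝ) {p}, p ∈ V → c • p ∈ V := fun c _ hp => V.smul_mem c hp
  simp only [Fin.forall_fin_two, Fin.forall_fin_one]
  refine ⟨⟨⟨h44, h422⟩, h422, h2222⟩,
    ⟨⟨sub_mem h422 h2222, sub_mem h62 h422⟩, sub_mem h62 h422, sub_mem h8 h44⟩,
    add_mem (sub_mem (add_mem (add_mem (hs _ h8) (hs _ h62)) (hs _ h44)) (hs _ h422)) h2222,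
    ⟨⟨sub_mem h2222 (hs _ h422), sub_mem (hs _ h422) (hs _ h62)⟩,
      sub_mem (hs _ h422) (hs _ h62), sub_mem (add_mem (hs _ h62) (hs _ h44)) (hs _ h8)⟩,
    sub_mem h62 h44,
    sub_mem (add_mem (add_mem (sub_mem h2222 (hs _ h422)) (hs _ h44)) (hs _ h62)) (hs _ h8),
    sub_mem (add_mem (sub_mem (sub_mem (hs _ h8) (hs _ h62)) (hs _ h44)) (hs _ h422)) h2222⟩

/-- Every polynomial with a block representation is an even symmetric octic. -/
theorem HasBlockRepresentation.mem_invariantForms {n : ℕ} {f : MvPolynomial (Fin n) ℝ}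
    (hf : HasBlockRepresentation n f) : f ∈ invariantForms n 8 := by
  obtain ⟨A₁, A₂, A₃, A₄, A₅, A₆, A₇, -, -, -, -, -, -, -, rfl⟩ := hf
  obtain ⟨h₁, h₂, h₄, h₃, h₅, h₆, h₇⟩ := blocks_mem (V := invariantForms n 8)
    (pm_mem_invariantForms n (l := [8]) (by decide))
    (pm_mem_invariantForms n (l := [6, 2]) (by decide))
    (pm_mem_invariantForms n (l := [4, 4]) (by decide))
    (pm_mem_invariantForms n (l := [4, 2, 2]) (by decide))
    (pm_mem_invariantForms n (l := [2, 2, 2, 2]) (by decide))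
  exact add_mem (add_mem (add_mem (add_mem (add_mem (add_mem
    (trMul_mem_invariantForms _ h₁) (trMul_mem_invariantForms _ h₂))
    (trMul_mem_invariantForms _ h₄)) (trMul_mem_invariantForms _ h₃))
    (trMul_mem_invariantForms _ h₅)) (trMul_mem_invariantForms _ h₆))
    (trMul_mem_invariantForms _ h₇)

/-! ### The convex cone of block functions -/

lemma posSemidef_fin_one {a : ℝ} (ha : 0 ≤ a) : (!![a] : Matrix (Fin 1) (Fin 1) ℝ).PosSemidef := by
  have : (!![a] : Matrix (Fin 1) (Fin 1) ℝ) = Matrix.diagonal fun _ => a := by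
    ext i j; fin_cases i; fin_cases j; rfl
  rw [this]
  exact Matrix.PosSemidef.diagonal fun _ => ha

lemma posSemidef_sum_vec {ι : Type*} [Fintype ι] {κ : ℝ} (hκ : 0 ≤ κ) (u v : ι → ℝ) :
    (!![κ * ∑ i, u i * u i, κ * ∑ i, u i * v i; κ * ∑ i, u i * v i, κ * ∑ i, v i * v i] :
      Matrix (Fin 2) (Fin 2) ℝ).PosSemidef := by
  have : (!![κ * ∑ i, u i * u i, κ * ∑ i, u i * v i; κ * ∑ i, u i * v i, κ * ∑ i, v i * v i] :
      Matrix (Fin 2) (Fin 2) ℝ) =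
      κ • ∑ i, Matrix.vecMulVec ![u i, v i] (star ![u i, v i]) := by
    ext a b
    fin_cases a <;> fin_cases b <;>
      simp [Matrix.sum_apply, mul_comm]
  rw [this]
  exact (Matrix.posSemidef_sum _ fun i _ => Matrix.posSemidef_vecMulVec_self_star _).smul hκ

lemma eval_trMul_fin_one {n : ℕ} (a : ℝ) (B : Matrix (Fin 1) (Fin 1) (MvPolynomial (Fin n) ℝ))
    (x : Fin n → ℝ) : eval x (trMul !![a] B) = a * eval x (B 0 0) := by
  simp [trMul, Matrix.trace, Matrix.mul_apply]

lemma eval_trMul_fin_two {n : ℕ} (a b d : ℝ)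
    (B : Matrix (Fin 2) (Fin 2) (MvPolynomial (Fin n) ℝ)) (x : Fin n → ℝ) :
    eval x (trMul !![a, b; b, d] B) =
      a * eval x (B 0 0) + b * (eval x (B 0 1) + eval x (B 1 0)) + d * eval x (B 1 1) := by
  simp [trMul, Matrix.trace, Matrix.mul_apply, Fin.sum_univ_two]
  ring

lemma trMul_zero {n k : ℕ} (B : Matrix (Fin k) (Fin k) (MvPolynomial (Fin n) ℝ)) :
    trMul 0 B = 0 := by
  simp [trMul]

lemma trMul_add {n k : ℕ} (A A' : Matrix (Fin k) (Fin k) ℝ)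
    (B : Matrix (Fin k) (Fin k) (MvPolynomial (Fin n) ℝ)) :
    trMul (A + A') B = trMul A B + trMul A' B := by
  simp [trMul, Matrix.map_add, Matrix.add_mul]

/-- `F` is the function of a polynomial with a block representation. -/
def IsBlockFunction (n : ℕ) (F : (Fin n → ℝ) → ℝ) : Prop :=
  ∃ g, HasBlockRepresentation n g ∧ ∀ x, eval x g = F x

lemma IsBlockFunction.zero (n : ℕ) : IsBlockFunction n fun _ => 0 := by
  refine ⟨0, ⟨0, 0, 0, 0, 0, 0, 0, .zero, .zero, .zero, .zero, .zero, .zero, .zero, ?_⟩, by simp⟩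
  simp [trMul_zero]

lemma IsBlockFunction.add {n : ℕ} {F G : (Fin n → ℝ) → ℝ} (hF : IsBlockFunction n F)
    (hG : IsBlockFunction n G) : IsBlockFunction n fun x => F x + G x := by
  obtain ⟨f, ⟨A₁, A₂, A₃, A₄, A₅, A₆, A₇, h₁, h₂, h₃, h₄, h₅, h₆, h₇, hf⟩, hF⟩ := hF
  obtain ⟨g, ⟨A₁', A₂', A₃', A₄', A₅', A₆', A₇', h₁', h₂', h₃', h₄', h₅', h₆', h₇', hg⟩, hG⟩ := hG
  refine ⟨f + g, ⟨A₁ + A₁', A₂ + A₂', A₃ + A₃', A₄ + A₄', A₅ + A₅', A₆ + A₆', A₇ + A₇', h₁.add h₁',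
    h₂.add h₂', h₃.add h₃', h₄.add h₄', h₅.add h₅', h₆.add h₆', h₇.add h₇', ?_⟩,
    fun x => by rw [map_add, hF, hG]⟩
  rw [hf, hg]
  simp only [trMul_add]
  ring

lemma IsBlockFunction.sum {n : ℕ} {ι : Type*} (s : Finset ι) {F : ι → (Fin n → ℝ) → ℝ}
    (hF : ∀ i ∈ s, IsBlockFunction n (F i)) : IsBlockFunction n fun x => ∑ i ∈ s, F i x := by
  classical
  induction s using Finset.induction_on with
  | empty => simpa using IsBlockFunction.zero n
  | insert a s ha ih =>
    simp only [Finset.sum_insert ha]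
    exact (hF a (Finset.mem_insert_self a s)).add
      (ih fun i hi => hF i (Finset.mem_insert_of_mem hi))

/-! ### Averaged squares of linear and quadratic forms -/

section

variable {n : ℕ} {c₀ c₁ c₂ c₃ c₄ : ℝ} {y : Fin n → ℝ}

/-- A symmetric quadratic form against the orbit means with two fixed indices. -/
lemma sum_mul_orbitMean (h : HasOrbitParams y c₀ c₁ c₂ c₃ c₄) (a : Fin n → Fin n → ℝ)
    (ha : ∀ i j, a i j = a j i) (i j : Fin n) :
    ∑ k, ∑ l, a k l * orbitMean y i j k l =
      c₀ * (∑ k, ∑ l, a k l)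
      + c₁ * ((if i = j then 1 else 0) * (∑ k, ∑ l, a k l) + 2 * (∑ l, a i l) + 2 * (∑ l, a j l)
        + ∑ k, a k k)
      + c₂ * ((if i = j then 1 else 0) * (∑ k, a k k) + 2 * a i j)
      + c₃ * ((if i = j then 1 else 0) * (2 * ∑ l, a i l) + a i i + a j j)
      + c₄ * ((if i = j then 1 else 0) * a i i) := by
  have e₁ : ∀ i, ∑ k, ∑ l, a k l * (if i = k then 1 else 0) = ∑ l, a i l := fun i => by
    rw [Finset.sum_comm]; simp
  have e₂ : ∀ i, ∑ k, ∑ l, a k l * (if i = l then 1 else 0) = ∑ l, a i l := fun i => by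
    simp [ha i]
  have e₃ : ∑ k, ∑ l, a k l * (if k = l then 1 else 0) = ∑ k, a k k := by simp
  have e₄ : ∀ i j, ∑ k, ∑ l, a k l * ((if i = k then 1 else 0) * (if j = l then 1 else 0)) = a i j :=
    fun i j => by simp
  have e₅ : ∀ i j, ∑ k, ∑ l, a k l * ((if i = l then 1 else 0) * (if j = k then 1 else 0)) = a i j :=
    fun i j => by rw [Finset.sum_comm]; simp [ha i j]
  have hexp : ∀ k l, a k l * orbitMean y i j k l =
      (c₀ + c₁ * (if i = j then 1 else 0)) * a k l
      + (c₁ + c₃ * (if i = j then 1 else 0)) * (a k l * (if i = k then 1 else 0))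
      + (c₁ + c₃ * (if i = j then 1 else 0)) * (a k l * (if i = l then 1 else 0))
      + c₁ * (a k l * (if j = k then 1 else 0))
      + c₁ * (a k l * (if j = l then 1 else 0))
      + (c₁ + c₂ * (if i = j then 1 else 0)) * (a k l * (if k = l then 1 else 0))
      + c₂ * (a k l * ((if i = k then 1 else 0) * (if j = l then 1 else 0)))
      + c₂ * (a k l * ((if i = l then 1 else 0) * (if j = k then 1 else 0)))
      + (c₃ + c₄ * (if i = j then 1 else 0)) *
        (a k l * ((if i = k then 1 else 0) * (if i = l then 1 else 0)))
      + c₃ * (a k l * ((if j = k then 1 else 0) * (if j = l then 1 else 0))) := fun k l => by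
    rw [h]; ring
  simp only [hexp, Finset.sum_add_distrib, ← Finset.mul_sum, e₁, e₂, e₃, e₄, e₅]
  ring

/-- The matrix enters only through six quantities: total sum, trace, squared norms of the row sums,
of the diagonal and of all entries, and the pairing of row sums with the diagonal. This is what
makes the final comparison with the blocks a rational identity. -/
lemma sum_sum_mul_orbitMean (h : HasOrbitParams y c₀ c₁ c₂ c₃ c₄) (a : Fin n → Fin n → ℝ)
    (ha : ∀ i j, a i j = a j i) :
    ∑ i, ∑ j, a i j * ∑ k, ∑ l, a k l * orbitMean y i j k l =
      c₀ * (∑ i, ∑ j, a i j) ^ 2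
      + c₁ * (2 * (∑ i, ∑ j, a i j) * (∑ i, a i i) + 4 * ∑ i, (∑ j, a i j) ^ 2)
      + c₂ * ((∑ i, a i i) ^ 2 + 2 * ∑ i, ∑ j, a i j ^ 2)
      + c₃ * (4 * ∑ i, (∑ j, a i j) * a i i) + c₄ * ∑ i, a i i ^ 2 := by
  simp only [sum_mul_orbitMean h a ha]
  generalize hs : ∑ i, ∑ j, a i j = s
  generalize ht : ∑ i, a i i = t
  have hexp : ∀ i j, a i j * (c₀ * s
      + c₁ * ((if i = j then 1 else 0) * s + 2 * (∑ l, a i l) + 2 * (∑ l, a j l) + t)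
      + c₂ * ((if i = j then 1 else 0) * t + 2 * a i j)
      + c₃ * ((if i = j then 1 else 0) * (2 * ∑ l, a i l) + a i i + a j j)
      + c₄ * ((if i = j then 1 else 0) * a i i)) =
      (c₀ * s + c₁ * t) * a i j + (c₁ * s + c₂ * t) * (a i j * (if i = j then 1 else 0))
      + 2 * c₁ * (a i j * ∑ l, a i l) + 2 * c₁ * (a i j * ∑ l, a j l) + 2 * c₂ * a i j ^ 2
      + 2 * c₃ * ((a i j * ∑ l, a i l) * (if i = j then 1 else 0)) + c₃ * (a i j * a i i)
      + c₃ * (a i j * a j j) + c₄ * ((a i j * a i i) * (if i = j then 1 else 0)) := fun i j => by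
    ring
  have e₁ : ∑ i, ∑ j, a i j * ∑ l, a i l = ∑ i, (∑ j, a i j) ^ 2 := by
    simp only [← Finset.sum_mul, sq]
  have e₂ : ∑ i, ∑ j, a i j * ∑ l, a j l = ∑ i, (∑ j, a i j) ^ 2 := by
    rw [Finset.sum_comm, ← e₁]
    exact Finset.sum_congr rfl fun i _ => Finset.sum_congr rfl fun j _ => by rw [ha]
  have e₃ : ∑ i, ∑ j, a i j * a i i = ∑ i, (∑ j, a i j) * a i i := by
    simp only [← Finset.sum_mul]
  have e₄ : ∑ i, ∑ j, a i j * a j j = ∑ i, (∑ j, a i j) * a i i := by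
    rw [Finset.sum_comm, ← e₃]
    exact Finset.sum_congr rfl fun i _ => Finset.sum_congr rfl fun j _ => by rw [ha]
  simp only [hexp, Finset.sum_add_distrib, ← Finset.mul_sum, e₁, e₂, e₃, e₄, hs]
  simp only [mul_ite, mul_one, mul_zero, Finset.sum_ite_eq, Finset.mem_univ, if_true, ht]
  have e₅ : ∑ i, a i i * ∑ l, a i l = ∑ i, (∑ j, a i j) * a i i :=
    Finset.sum_congr rfl fun i _ => mul_comm _ _
  rw [e₅]
  simp only [← sq]
  ring

end

lemma permMean_sq_quadratic {n : ℕ} (y : Fin n → ℝ) (a : Fin n → Fin n → ℝ) :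
    ((n.factorial : ℝ))⁻¹ * ∑ σ : Equiv.Perm (Fin n),
      (∑ i, ∑ j, a i j * (y (σ i) * y (σ j))) ^ 2 =
    ∑ i, ∑ j, a i j * ∑ k, ∑ l, a k l * orbitMean y i j k l := by
  have h := sum_orbitMean Finset.univ
    (fun m : Fin n × Fin n × Fin n × Fin n => a m.1 m.2.1 * a m.2.2.1 m.2.2.2)
    (fun m => m.1) (fun m => m.2.1) (fun m => m.2.2.1) (fun m => m.2.2.2) y
  simp only [Fintype.sum_prod_type] at h
  have hsq : ∀ F : Fin n → Fin n → ℝ, (∑ i, ∑ j, F i j) ^ 2 =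
      ∑ i, ∑ j, ∑ k, ∑ l, F i j * F k l := fun F => by
    rw [sq]
    generalize hS : ∑ i, ∑ j, F i j = S
    rw [← hS, Finset.sum_mul]
    simp only [Finset.sum_mul]
    simp only [← Finset.mul_sum, hS]
  have h' : ∀ i j, a i j * ∑ k, ∑ l, a k l * orbitMean y i j k l =
      ∑ k, ∑ l, a i j * a k l * orbitMean y i j k l := fun i j => by
    simp only [Finset.mul_sum, mul_assoc]
  simp only [h', h, hsq]
  congr 1
  refine Finset.sum_congr rfl fun σ _ => Finset.sum_congr rfl fun i _ =>
    Finset.sum_congr rfl fun j _ => Finset.sum_congr rfl fun k _ =>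
    Finset.sum_congr rfl fun l _ => by ring

lemma permMean_sq_linear {n : ℕ} (y : Fin n → ℝ) (b : Fin n → ℝ) (i j : Fin n) :
    ((n.factorial : ℝ))⁻¹ * ∑ σ : Equiv.Perm (Fin n),
      y (σ i) * y (σ j) * (∑ k, b k * y (σ k)) ^ 2 =
    ∑ k, ∑ l, b k * b l * orbitMean y i j k l := by
  have h := sum_orbitMean Finset.univ
    (fun m : Fin n × Fin n => b m.1 * b m.2) (fun m => i) (fun m => j) (fun m => m.1)
    (fun m => m.2) y
  simp only [Fintype.sum_prod_type] at h
  rw [h]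
  congr 1
  refine Finset.sum_congr rfl fun σ _ => ?_
  rw [sq, Finset.sum_mul_sum, Finset.mul_sum]
  refine Finset.sum_congr rfl fun k _ => ?_
  rw [Finset.mul_sum]
  exact Finset.sum_congr rfl fun l _ => by ring

/-! ### Block representations for the three parity types -/

theorem isBlockFunction_quadruple {n : ℕ} (hn : 4 ≤ n) {i j k l : Fin n} (h₁ : i ≠ j) (h₂ : i ≠ k)
    (h₃ : i ≠ l) (h₄ : j ≠ k) (h₅ : j ≠ l) (h₆ : k ≠ l) (c : ℝ) :
    IsBlockFunction n fun x => ((n.factorial : ℝ))⁻¹ * ∑ σ : Equiv.Perm (Fin n),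
      (c * (x (σ i) * x (σ j) * x (σ k) * x (σ l))) ^ 2 := by
  have hK := blockCoeff_pos hn
  refine ⟨_, ⟨0, 0, 0, 0, 0, !![c ^ 2 / (((n : ℝ) - 1) * (n - 2) * (n - 3) / (n : ℝ) ^ 3)], 0,
    .zero, .zero, .zero, .zero, .zero, posSemidef_fin_one (by positivity), .zero, rfl⟩,
    fun x => ?_⟩
  obtain ⟨c₀, c₁, c₂, c₃, c₄, h⟩ := exists_orbitMean_eq hn fun i => x i ^ 2
  simp only [trMul_zero, zero_add, add_zero]
  rw [eval_trMul_fin_one, eval_blockN4_4 hn x h, ← mul_assoc, div_mul_cancel₀ _ hK.ne']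
  have hr := h i j k l
  simp only [h₁, h₂, h₃, h₄, h₅, h₆, if_false, add_zero, mul_zero] at hr
  rw [← hr, orbitMean, mul_left_comm, Finset.mul_sum]
  congr 1
  exact Finset.sum_congr rfl fun σ _ => by ring

/-- Let $\beta$ be the mean of the $b_k$ with $k\ne i,j$. The linear form splits into $\beta\sum_k
y_k+(\frac{b_i+b_j}2-\beta)(y_i+y_j)$, the antisymmetric part $\frac{b_i-b_j}2(y_i-y_j)$, and a form
in the other variables with coefficient sum zero. These feed the blocks `blockN2_2`, `blockN2_11`
and `blockN31_2` respectively, and the cross terms average to zero. -/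
theorem isBlockFunction_pair {n : ℕ} (hn : 4 ≤ n) {i j : Fin n} (hij : i ≠ j) (b : Fin n → ℝ) :
    IsBlockFunction n fun x => ((n.factorial : ℝ))⁻¹ * ∑ σ : Equiv.Perm (Fin n),
      (x (σ i) * x (σ j) * ∑ k, b k * x (σ k) ^ 2) ^ 2 := by
  have hn0 := cast_ne_zero_of_four_le hn
  have hn4 : (4 : ℝ) ≤ n := by exact_mod_cast hn
  have hn1 : 0 < (n : ℝ) - 1 := by linarith
  have hn2 : 0 < (n : ℝ) - 2 := by linarith
  have hn3 : 0 < (n : ℝ) - 3 := by linarith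
  set S := ∑ k, b k with hS
  set B := ∑ k, b k ^ 2 with hB
  -- By Cauchy–Schwarz: this is the sum of squared deviations of the $n-2$ coefficients away from
  -- `i` and `j`.
  have hV : 0 ≤ B - b i ^ 2 - b j ^ 2 - (S - b i - b j) ^ 2 / (n - 2) := by
    have hj : j ∈ Finset.univ.erase i := by simp [hij.symm]
    have h := sq_sum_le_card_mul_sum_sq (s := (Finset.univ.erase i).erase j) (f := b)
    rw [Finset.card_erase_of_mem hj, Finset.card_erase_of_mem (Finset.mem_univ i),
      Finset.card_univ, Fintype.card_fin, Finset.sum_erase_eq_sub hj,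
      Finset.sum_erase_eq_sub (Finset.mem_univ i), Finset.sum_erase_eq_sub hj,
      Finset.sum_erase_eq_sub (Finset.mem_univ i), Nat.sub_sub, Nat.cast_sub (by omega)] at h
    rw [sub_nonneg, div_le_iff₀ hn2]
    norm_num at h
    linarith
  -- The factors $n/(n-1)$ and $2n/(n-1)$ convert the normalisations $1/n^2$ and $1/(2n^2)$ of the
  -- blocks into the mean over ordered pairs of distinct indices.
  refine ⟨_, ⟨0, 0, _, 0, !![2 * n / (n - 1) * ((b i - b j) / 2) ^ 2], 0,
    !![(n : ℝ) ^ 3 / ((n - 1) * (n - 2) * (n - 3)) *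
      (B - b i ^ 2 - b j ^ 2 - (S - b i - b j) ^ 2 / (n - 2))],
    .zero, .zero, posSemidef_sum_vec (κ := n / (n - 1)) (by positivity)
      (fun _ : Unit => (S - b i - b j) / (n - 2) * n)
      (fun _ : Unit => (b i + b j) / 2 - (S - b i - b j) / (n - 2)),
    .zero, posSemidef_fin_one (by positivity), .zero, posSemidef_fin_one (by positivity), rfl⟩,
    fun x => ?_⟩
  obtain ⟨c₀, c₁, c₂, c₃, c₄, h⟩ := exists_orbitMean_eq hn fun i => x i ^ 2
  obtain ⟨h8, h62, h44, h422, h2222⟩ := eval_powerMeans hn x h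
  have hL : ((n.factorial : ℝ))⁻¹ * ∑ σ : Equiv.Perm (Fin n),
      (x (σ i) * x (σ j) * ∑ k, b k * x (σ k) ^ 2) ^ 2 =
      c₀ * S ^ 2 + c₁ * (2 * b i * S + 2 * b j * S + B) + c₂ * (2 * (b i * b j))
        + c₃ * (b i ^ 2 + b j ^ 2) := by
    have h₁ := permMean_sq_linear (fun i => x i ^ 2) b i j
    rw [sum_mul_orbitMean h (fun k l => b k * b l) (fun _ _ => mul_comm _ _) i j] at h₁
    simp only [hij, if_false, ← Finset.mul_sum, ← Finset.sum_mul, ← sq, ← hS, ← hB] at h₁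
    refine Eq.trans ?_ (h₁.trans ?_)
    · congr 1
      exact Finset.sum_congr rfl fun σ _ => by ring
    · ring
  refine Eq.trans ?_ hL.symm
  simp only [trMul_zero, zero_add, add_zero, map_add, eval_trMul_fin_one, eval_trMul_fin_two,
    eval_blockN31_2 hn x h, Finset.univ_unique, Finset.sum_singleton]
  simp only [blockN2_2, blockN2_11, Matrix.of_apply, Matrix.cons_val', Matrix.cons_val_zero,
    Matrix.cons_val_one, Matrix.cons_val_fin_one, map_add, map_sub, smul_eval, h8, h62, h44, h422,
    h2222]
  field_simp
  ring

/-- The symmetric matrix splits orthogonally into a trivial part (constant diagonal, constant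
off-diagonal), a standard part given by the vectors $u$ and $v$ of sum zero, and a remainder with
zero diagonal and zero row sums. These feed `blockN`, `blockN11` and `blockN22`. -/
theorem isBlockFunction_quadratic {n : ℕ} (hn : 4 ≤ n) (a : Fin n → Fin n → ℝ)
    (ha : ∀ i j, a i j = a j i) :
    IsBlockFunction n fun x => ((n.factorial : ℝ))⁻¹ * ∑ σ : Equiv.Perm (Fin n),
      (∑ i, ∑ j, a i j * (x (σ i) ^ 2 * x (σ j) ^ 2)) ^ 2 := by
  have hn0 := cast_ne_zero_of_four_le hn
  have hn4 : (4 : ℝ) ≤ n := by exact_mod_cast hn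
  have hn1 : 0 < (n : ℝ) - 1 := by linarith
  have hn2 : 0 < (n : ℝ) - 2 := by linarith
  have hn3 : 0 < (n : ℝ) - 3 := by linarith
  obtain ⟨s, hs⟩ : ∃ s, s = ∑ i, ∑ j, a i j := ⟨_, rfl⟩
  obtain ⟨t, ht⟩ : ∃ t, t = ∑ i, a i i := ⟨_, rfl⟩
  obtain ⟨R, hR⟩ : ∃ R, R = ∑ i, (∑ j, a i j) ^ 2 := ⟨_, rfl⟩
  obtain ⟨M, hM⟩ : ∃ M, M = ∑ i, (∑ j, a i j) * a i i := ⟨_, rfl⟩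
  obtain ⟨D, hD⟩ : ∃ D, D = ∑ i, a i i ^ 2 := ⟨_, rfl⟩
  obtain ⟨Q, hQ⟩ : ∃ Q, Q = ∑ i, ∑ j, a i j ^ 2 := ⟨_, rfl⟩
  -- the off-diagonal part of `a` is `m + u i + u j` plus a part with vanishing row sums
  obtain ⟨m, hm⟩ : ∃ m, m = (s - t) / (n * (n - 1)) := ⟨_, rfl⟩
  obtain ⟨u, hu⟩ : ∃ u : Fin n → ℝ, ∀ i, u i = (∑ j, a i j - a i i - (s - t) / n) / (n - 2) :=
    ⟨_, fun _ => rfl⟩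
  obtain ⟨v, hv⟩ : ∃ v : Fin n → ℝ, ∀ i, v i = a i i - t / n := ⟨_, fun _ => rfl⟩
  have hcard : ∑ _i : Fin n, (1 : ℝ) = n := by simp
  have hu0 : ∑ i, u i = 0 := by
    simp only [hu, ← Finset.sum_div, Finset.sum_sub_distrib, ← hs, ← ht]
    simp
    field_simp
    simp
  have huu : ∑ i, u i * u i = (R - 2 * M + D - (s - t) ^ 2 / n) / (n - 2) ^ 2 := by
    have : ∀ i, u i * u i = ((∑ j, a i j) ^ 2 - 2 * ((∑ j, a i j) * a i i) + a i i ^ 2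
        - 2 * ((s - t) / n) * (∑ j, a i j) + 2 * ((s - t) / n) * a i i
        + ((s - t) / n) ^ 2 * 1) / (n - 2) ^ 2 := fun i => by
      rw [hu]; field_simp; ring
    simp only [this, ← Finset.sum_div, Finset.sum_add_distrib, Finset.sum_sub_distrib,
      ← Finset.mul_sum, ← hs, ← ht, ← hR, ← hM, ← hD, hcard]
    field_simp
    ring
  have huv : ∑ i, u i * v i = (M - D - (s - t) * t / n) / (n - 2) := by
    have : ∀ i, u i * v i = ((∑ j, a i j) * a i i - a i i ^ 2 - (s - t) / n * a i i
        - t / n * (∑ j, a i j) + t / n * a i i + (s - t) / n * (t / n) * 1) / (n - 2) :=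
      fun i => by
      rw [hu, hv]; field_simp; ring
    simp only [this, ← Finset.sum_div, Finset.sum_add_distrib, Finset.sum_sub_distrib,
      ← Finset.mul_sum, ← hs, ← ht, ← hM, ← hD, hcard]
    field_simp
    ring
  have hvv : ∑ i, v i * v i = D - t ^ 2 / n := by
    have : ∀ i, v i * v i = a i i ^ 2 - 2 * (t / n) * a i i + (t / n) ^ 2 * 1 := fun i => by
      rw [hv]; ring
    simp only [this, Finset.sum_add_distrib, Finset.sum_sub_distrib,
      ← Finset.mul_sum, ← ht, ← hD, hcard]
    field_simp
    ring
  have hua : ∑ i, u i * ∑ j, a i j = (n - 2) * ∑ i, u i * u i + ∑ i, u i * a i i := by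
    have : ∀ i, u i * ∑ j, a i j =
        (n - 2) * (u i * u i) + u i * a i i + (s - t) / n * u i := fun i => by
      rw [hu]; field_simp; ring
    simp only [this, Finset.sum_add_distrib, ← Finset.mul_sum, hu0]
    ring
  -- This is the squared norm of the remainder $a_{ij}-m-u_i-u_j$ over $i\ne j$. The divisor $n-2$
  -- in `u` is what makes its row sums vanish.
  have hE : 0 ≤ Q - D - n * (n - 1) * m ^ 2
      - 2 * (R - 2 * M + D - (s - t) ^ 2 / n) / (n - 2) := by
    have h := sum_offDiag fun i j : Fin n => (a i j - m - u i - u j) ^ 2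
    have hpos : 0 ≤ ∑ p : Fin n × Fin n,
        (if p.1 = p.2 then 0 else (a p.1 p.2 - m - u p.1 - u p.2) ^ 2) :=
      Finset.sum_nonneg fun p _ => by split_ifs <;> positivity
    have h₁ : ∑ i, ∑ j, (a i j - m - u i - u j) ^ 2 = Q + n ^ 2 * m ^ 2
        + 2 * n * (∑ i, u i * u i) - 2 * m * s - 4 * ∑ i, u i * ∑ j, a i j := by
      have e : ∀ i j, (a i j - m - u i - u j) ^ 2 = a i j ^ 2 - 2 * m * a i j - 2 * (u i * a i j)
          - 2 * (u j * a j i) + m ^ 2 * 1 + u i * u i * 1 + u j * u j + 2 * m * u i * 1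
          + 2 * m * u j + 2 * u i * u j := fun i j => by rw [ha j i]; ring
      have e' : ∑ i, ∑ j, u j * a j i = ∑ i, u i * ∑ j, a i j := by
        rw [Finset.sum_comm]
        simp only [← Finset.mul_sum]
      simp only [e, Finset.sum_add_distrib, Finset.sum_sub_distrib, ← Finset.mul_sum, e',
        ← hQ, ← hs, hcard, ← Finset.sum_mul, hu0]
      simp
      ring
    have h₂ : ∑ i, (a i i - m - u i - u i) ^ 2 = D + n * m ^ 2 + 4 * (∑ i, u i * u i)
        - 2 * m * t - 4 * ∑ i, u i * a i i := by
      have e : ∀ i, (a i i - m - u i - u i) ^ 2 = a i i ^ 2 + m ^ 2 * 1 + 4 * (u i * u i)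
          - 2 * m * a i i - 4 * (u i * a i i) + 4 * m * u i := fun i => by ring
      simp only [e, Finset.sum_add_distrib, Finset.sum_sub_distrib, ← Finset.mul_sum,
        ← hD, ← ht, hcard, hu0]
      ring
    rw [h, h₁, h₂, hua, huu] at hpos
    refine hpos.trans_eq ?_
    rw [hm]
    field_simp
    ring
  -- The trivial part is $(t-nm)p_4+n^2m\,p_2^2$. The standard part is
  -- $\sum_i\bigl(2nu_i\,p_2y_i+(v_i-2u_i)y_i^2\bigr)$. The remainder contributes $2c_2$ times its
  -- squared norm.
  refine ⟨_, ⟨_, _, 0, !![2 * (n : ℝ) ^ 3 / ((n - 1) * (n - 2) * (n - 3)) *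
      (Q - D - n * (n - 1) * m ^ 2 - 2 * (R - 2 * M + D - (s - t) ^ 2 / n) / (n - 2))], 0, 0, 0,
    posSemidef_sum_vec (κ := 1) zero_le_one (fun _ : Unit => t - n * m)
      (fun _ : Unit => n ^ 2 * m),
    posSemidef_sum_vec (κ := n / (n - 1)) (by positivity) (fun i => 2 * n * u i)
      (fun i => v i - 2 * u i),
    .zero, posSemidef_fin_one (by positivity), .zero, .zero, .zero, rfl⟩, fun x => ?_⟩
  obtain ⟨c₀, c₁, c₂, c₃, c₄, h⟩ := exists_orbitMean_eq hn fun i => x i ^ 2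
  obtain ⟨h8, h62, h44, h422, h2222⟩ := eval_powerMeans hn x h
  have hL := permMean_sq_quadratic (fun i => x i ^ 2) a
  rw [sum_sum_mul_orbitMean h a ha, ← hs, ← ht, ← hR, ← hM, ← hD, ← hQ] at hL
  refine Eq.trans ?_ hL.symm
  have e₁ : ∑ i, 2 * n * u i * (2 * n * u i) = 4 * n ^ 2 * ∑ i, u i * u i := by
    rw [Finset.mul_sum]
    exact Finset.sum_congr rfl fun i _ => by ring
  have e₂ : ∑ i, 2 * n * u i * (v i - 2 * u i) =
      2 * n * (∑ i, u i * v i) - 4 * n * ∑ i, u i * u i := by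
    rw [Finset.mul_sum, Finset.mul_sum, ← Finset.sum_sub_distrib]
    exact Finset.sum_congr rfl fun i _ => by ring
  have e₃ : ∑ i, (v i - 2 * u i) * (v i - 2 * u i) =
      ∑ i, v i * v i - 4 * (∑ i, u i * v i) + 4 * ∑ i, u i * u i := by
    rw [Finset.mul_sum, Finset.mul_sum, ← Finset.sum_sub_distrib, ← Finset.sum_add_distrib]
    exact Finset.sum_congr rfl fun i _ => by ring
  simp only [trMul_zero, add_zero, map_add, eval_trMul_fin_one, eval_trMul_fin_two,
    eval_blockN22 hn x h, Finset.univ_unique, Finset.sum_singleton, e₁, e₂, e₃, huu, huv, hvv, hm]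
  simp only [blockN, blockN11, Matrix.of_apply, Matrix.cons_val', Matrix.cons_val_zero,
    Matrix.cons_val_one, Matrix.cons_val_fin_one, map_sub, h8, h62, h44, h422, h2222]
  field_simp
  ring

/-! ### Summands of a sum of squares are forms -/

/-- A bounded polynomial is constant. For positive `m` the bound forces a zero at the origin, so a
factor $X$ can be removed from both sides. -/
lemma polynomial_eval_eq_of_sq_le (m : ℕ) : ∀ (P : Polynomial ℝ) (c : ℝ),
    (∀ t, P.eval t ^ 2 ≤ c * (t ^ m) ^ 2) → ∀ t, P.eval t = t ^ m * P.eval 1 := by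
  induction m with
  | zero =>
    intro P c h t
    have hd : P.degree ≤ 0 := by
      by_contra hd
      push Not at hd
      have hlim := P.abs_tendsto_atTop hd
      obtain ⟨s, hs⟩ := (hlim.eventually_gt_atTop (|c| + 1)).exists
      have h' := h s
      rw [← sq_abs] at h'
      have := le_abs_self c
      nlinarith [abs_nonneg c]
    rw [Polynomial.eq_C_of_degree_le_zero hd]
    simp
  | succ m ih =>
    intro P c h t
    have h0 : P.eval 0 = 0 := by
      have := h 0
      simp only [zero_pow (Nat.succ_ne_zero m), ne_eq, OfNat.ofNat_ne_zero, not_false_eq_true,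
        zero_pow, mul_zero] at this
      exact pow_eq_zero_iff two_ne_zero |>.1 (le_antisymm this (sq_nonneg _))
    obtain ⟨Q, rfl⟩ : Polynomial.X ∣ P := by
      rw [Polynomial.X_dvd_iff, Polynomial.coeff_zero_eq_eval_zero, h0]
    -- Cancelling $s^2$ needs $s\ne0$; the origin is recovered by density and continuity.
    have hQ : ∀ s, Q.eval s ^ 2 ≤ c * (s ^ m) ^ 2 := by
      have hcl : IsClosed {s : ℝ | Q.eval s ^ 2 ≤ c * (s ^ m) ^ 2} :=
        isClosed_le (by fun_prop) (by fun_prop)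
      have hd : Dense ({0}ᶜ : Set ℝ) := dense_compl_singleton 0
      intro s
      refine hcl.closure_subset_iff.2 (fun s hs => ?_) (hd s)
      have hs2 : 0 < s ^ 2 := by
        have : s ≠ 0 := hs
        positivity
      have := h s
      simp only [Polynomial.eval_mul, Polynomial.eval_X] at this
      refine le_of_mul_le_mul_left ?_ hs2
      calc s ^ 2 * Q.eval s ^ 2 = (s * Q.eval s) ^ 2 := by ring
        _ ≤ _ := this
        _ = _ := by ring
    rw [Polynomial.eval_mul, Polynomial.eval_X, ih Q c hQ t]
    simp
    ring

lemma coeff_eval_scale {n : ℕ} (r : ℝ) (q : MvPolynomial (Fin n) ℝ) (a : Fin n →₀ ℕ) :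
    coeff a (aeval (fun i => C r * X i : Fin n → MvPolynomial (Fin n) ℝ) q) =
      r ^ a.degree * coeff a q := by
  induction q using MvPolynomial.induction_on' with
  | add p q hp hq => simp only [map_add, coeff_add, hp, hq, mul_add]
  | monomial b c =>
    have : aeval (fun i => C r * X i : Fin n → MvPolynomial (Fin n) ℝ) (monomial b c) =
        monomial b (r ^ b.degree * c) := by
      rw [aeval_monomial, Finsupp.prod_fintype _ _ (fun i => pow_zero _), Finsupp.degree_eq_sum,
        monomial_eq, Finsupp.prod_fintype _ _ (fun i => pow_zero _)]
      simp only [mul_pow, Finset.prod_mul_distrib, Finset.prod_pow_eq_pow_sum, algebraMap_eq,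
        C_mul, C_pow]
      ring
    rw [this, coeff_monomial, coeff_monomial]
    split_ifs with h
    · rw [h]
    · simp

lemma eval_aeval_scale {n : ℕ} (r : ℝ) (q : MvPolynomial (Fin n) ℝ) (x : Fin n → ℝ) :
    eval x (aeval (fun i => C r * X i : Fin n → MvPolynomial (Fin n) ℝ) q) = eval (r • x) q := by
  induction q using MvPolynomial.induction_on with
  | C a => simp
  | add p q hp hq => simp only [map_add, hp, hq]
  | mul_X p i hp => simp only [map_mul, hp, aeval_X, eval_C, eval_X, Pi.smul_apply, smul_eq_mul]

lemma eval_smul_of_isHomogeneous {n d : ℕ} {f : MvPolynomial (Fin n) ℝ} (hf : f.IsHomogeneous d)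
    (r : ℝ) (x : Fin n → ℝ) : eval (r • x) f = r ^ d * eval x f := by
  have h : aeval (fun i => C r * X i : Fin n → MvPolynomial (Fin n) ℝ) f = C (r ^ d) * f := by
    ext a
    rw [coeff_eval_scale, coeff_C_mul]
    by_cases ha : coeff a f = 0
    · simp [ha]
    · rw [← hf ha, Finsupp.degree_eq_weight_one]
      rfl
  rw [← eval_aeval_scale, h, map_mul, eval_C]

lemma eval_aeval_line {n : ℕ} (q : MvPolynomial (Fin n) ℝ) (x : Fin n → ℝ) (s : ℝ) :
    (aeval (fun i => Polynomial.C (x i) * Polynomial.X : Fin n → Polynomial ℝ) q).eval s =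
      eval (s • x) q := by
  induction q using MvPolynomial.induction_on with
  | C a => simp
  | add p q hp hq => simp only [map_add, Polynomial.eval_add, hp, hq]
  | mul_X p i hp =>
    simp only [map_mul, Polynomial.eval_mul, hp, aeval_X, eval_X, Polynomial.eval_C,
      Polynomial.eval_X, Pi.smul_apply, smul_eq_mul]
    ring

/-- If the square of `q` is dominated by a form of degree `2 d`, then `q` is a form of degree
`d`. -/
lemma degree_eq_of_sq_le {n d : ℕ} {f q : MvPolynomial (Fin n) ℝ}
    (hf : f.IsHomogeneous (2 * d)) (h : ∀ x, eval x q ^ 2 ≤ eval x f) {a : Fin n →₀ ℕ}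
    (ha : coeff a q ≠ 0) : a.degree = d := by
  -- Restricting to the line through `x` reduces to one variable, where `f` is a constant multiple
  -- of $t^{2d}$.
  have key : ∀ (x : Fin n → ℝ) (t : ℝ), eval (t • x) q = t ^ d * eval x q := by
    intro x t
    have := polynomial_eval_eq_of_sq_le d _ (eval x f) (fun s => by
      rw [eval_aeval_line q x]
      refine (h _).trans_eq ?_
      rw [eval_smul_of_isHomogeneous hf]
      ring) t
    rw [eval_aeval_line, eval_aeval_line, one_smul] at this
    exact this
  -- Scaling by 2 alone suffices, since $2^{\deg a}=2^d$ determines the degree.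
  have hq : aeval (fun i => C 2 * X i : Fin n → MvPolynomial (Fin n) ℝ) q = C (2 ^ d) * q := by
    apply MvPolynomial.funext
    intro x
    rw [map_mul, eval_C, ← key x 2, eval_aeval_scale]
  have := coeff_eval_scale 2 q a
  rw [hq, coeff_C_mul] at this
  have h2 := mul_right_cancel₀ ha this
  exact (Nat.pow_right_injective le_rfl (by exact_mod_cast h2)).symm

lemma exists_eq_sum_mul_self {n : ℕ} {f : MvPolynomial (Fin n) ℝ} (hf : IsSumSq f) :
    ∃ (m : ℕ) (q : Fin m → MvPolynomial (Fin n) ℝ), f = ∑ k, q k * q k := by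
  induction hf with
  | zero => exact ⟨0, Fin.elim0, by simp⟩
  | sq_add a _ ih =>
    obtain ⟨m, q, rfl⟩ := ih
    exact ⟨m + 1, Fin.cons a q, by simp [Fin.sum_univ_succ]⟩

/-! ### Parity decomposition and averaging over signs -/

/-- The set of the variables that occur with an odd exponent. -/
def oddSupport {n : ℕ} (a : Fin n →₀ ℕ) : Finset (Fin n) :=
  Finset.univ.filter fun i => Odd (a i)

/-- The function of the part of `q` made of the monomials whose variables with an odd exponent are
those in `S`. -/
noncomputable def parityPart {n : ℕ} (q : MvPolynomial (Fin n) ℝ) (S : Finset (Fin n))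
    (x : Fin n → ℝ) : ℝ :=
  ∑ a ∈ q.support with oddSupport a = S, coeff a q * ∏ i, x i ^ a i

/-- An even power absorbs the sign and an odd power keeps it, so a sign vector acts on each parity
part by a character. -/
lemma eval_signs {n : ℕ} (q : MvPolynomial (Fin n) ℝ) (ε : Fin n → ℤˣ) (x : Fin n → ℝ) :
    eval (fun i => ((ε i : ℤ) : ℝ) * x i) q =
      ∑ S, (∏ i ∈ S, ((ε i : ℤ) : ℝ)) * parityPart q S x := by
  have h : ∀ a : Fin n →₀ ℕ, ∏ i, (((ε i : ℤ) : ℝ) * x i) ^ a i =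
      (∏ i ∈ oddSupport a, ((ε i : ℤ) : ℝ)) * ∏ i, x i ^ a i := by
    intro a
    simp only [mul_pow, Finset.prod_mul_distrib]
    congr 1
    rw [oddSupport, Finset.prod_filter]
    refine Finset.prod_congr rfl fun i _ => ?_
    rcases Int.units_eq_one_or (ε i) with h | h <;> split_ifs with ho
    · simp [h]
    · simp [h]
    · simp [h, ho.neg_one_pow]
    · simp [h, (Nat.not_odd_iff_even.1 ho).neg_one_pow]
  rw [eval_eq', ← Finset.sum_fiberwise q.support oddSupport]
  refine Finset.sum_congr rfl fun S _ => ?_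
  rw [parityPart, Finset.mul_sum]
  refine Finset.sum_congr rfl fun a ha => ?_
  rw [h, (Finset.mem_filter.1 ha).2]
  ring

/-- Orthogonality of the characters of $\{\pm1\}^n$: the sum factors over coordinates, and a
coordinate in only one of the two sets contributes $1+(-1)$. -/
lemma sum_signs_mul {n : ℕ} (S T : Finset (Fin n)) :
    ∑ ε : Fin n → ℤˣ, (∏ i ∈ S, ((ε i : ℤ) : ℝ)) * ∏ i ∈ T, ((ε i : ℤ) : ℝ) =
      if S = T then 2 ^ n else 0 := by
  have h : ∀ ε : Fin n → ℤˣ, (∏ i ∈ S, ((ε i : ℤ) : ℝ)) * ∏ i ∈ T, ((ε i : ℤ) : ℝ) =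
      ∏ i, (if i ∈ S then ((ε i : ℤ) : ℝ) else 1) * (if i ∈ T then ((ε i : ℤ) : ℝ) else 1) := by
    intro ε
    rw [Finset.prod_mul_distrib, Finset.prod_ite_mem, Finset.prod_ite_mem, Finset.univ_inter,
      Finset.univ_inter]
  have hsum := Finset.prod_univ_sum (fun _ : Fin n => (Finset.univ : Finset ℤˣ))
    fun i e => (if i ∈ S then ((e : ℤ) : ℝ) else 1) * (if i ∈ T then ((e : ℤ) : ℝ) else 1)
  rw [Fintype.piFinset_univ] at hsum
  simp only [h]
  rw [← hsum]
  have hu : ∀ F : ℤˣ → ℝ, ∑ e, F e = F 1 + F (-1) := fun F => by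
    rw [show (Finset.univ : Finset ℤˣ) = {1, -1} from rfl, Finset.sum_pair (by decide)]
  simp only [hu]
  split_ifs with hST
  · subst hST
    rw [Finset.prod_congr rfl (g := fun _ => (2 : ℝ)) fun i _ => ?_]
    · simp
    · split_ifs <;> norm_num
  · obtain ⟨i, hi⟩ : ∃ i, ¬(i ∈ S ↔ i ∈ T) := by
      by_contra hc
      push Not at hc
      exact hST (Finset.ext hc)
    refine Finset.prod_eq_zero (Finset.mem_univ i) ?_
    by_cases h₁ : i ∈ S <;> by_cases h₂ : i ∈ T <;> simp [h₁, h₂] at hi ⊢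

lemma sum_signs_eval_sq {n : ℕ} (q : MvPolynomial (Fin n) ℝ) (x : Fin n → ℝ) :
    ∑ ε : Fin n → ℤˣ, eval (fun i => ((ε i : ℤ) : ℝ) * x i) q ^ 2 =
      2 ^ n * ∑ S, parityPart q S x ^ 2 := by
  simp only [eval_signs, sq, Finset.sum_mul_sum]
  rw [Finset.sum_comm, Finset.mul_sum]
  refine Finset.sum_congr rfl fun S _ => ?_
  rw [Finset.sum_comm]
  have : ∀ T, ∑ ε : Fin n → ℤˣ, (∏ i ∈ S, ((ε i : ℤ) : ℝ)) * parityPart q S x *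
      ((∏ i ∈ T, ((ε i : ℤ) : ℝ)) * parityPart q T x) =
      (if S = T then 2 ^ n else 0) * (parityPart q S x * parityPart q T x) := by
    intro T
    rw [← sum_signs_mul, Finset.sum_mul]
    exact Finset.sum_congr rfl fun ε _ => by ring
  simp only [this]
  simp

lemma eval_of_mem_invariantForms {n d : ℕ} {f : MvPolynomial (Fin n) ℝ}
    (hf : f ∈ invariantForms n d) (σ : Equiv.Perm (Fin n)) (ε : Fin n → ℤˣ) (x : Fin n → ℝ) :
    eval (fun i => ((ε i : ℤ) : ℝ) * x (σ i)) f = eval x f := by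
  conv_rhs => rw [← hf.2 σ ε]
  generalize f = g
  induction g using MvPolynomial.induction_on with
  | C a => simp [signedPerm]
  | add p q hp hq => simp only [map_add, hp, hq]
  | mul_X p i hp => simp only [map_mul, hp, signedPerm, aeval_X, eval_C, eval_X]

/-- An invariant sum of squares is the sum of the permutation means of the squares of the parity
parts. -/
lemma eval_eq_sum_permMean {n d m : ℕ} {f : MvPolynomial (Fin n) ℝ} (hf : f ∈ invariantForms n d)
    {q : Fin m → MvPolynomial (Fin n) ℝ} (hq : f = ∑ k, q k * q k) (x : Fin n → ℝ) :
    eval x f = ∑ k, ∑ S, ((n.factorial : ℝ))⁻¹ * ∑ σ : Equiv.Perm (Fin n),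
      parityPart (q k) S (fun i => x (σ i)) ^ 2 := by
  -- Invariance of `f` allows averaging over signs, which makes the cross terms in each $q_k^2$
  -- disappear.
  have h₁ : ∀ z : Fin n → ℝ, eval z f = ∑ k, ∑ S, parityPart (q k) S z ^ 2 := by
    intro z
    have h2 : ((2 : ℝ) ^ n) ≠ 0 := by positivity
    refine mul_left_cancel₀ h2 ?_
    have hc : ∑ _ε : Fin n → ℤˣ, eval z f = 2 ^ n * eval z f := by
      simp [Finset.card_univ, Fintype.card_pi]
    rw [← hc, Finset.mul_sum]
    simp only [← sum_signs_eval_sq]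
    rw [Finset.sum_comm]
    refine Finset.sum_congr rfl fun ε _ => ?_
    rw [← eval_of_mem_invariantForms hf 1 ε z, hq]
    simp [sq]
  have h₂ : ∀ σ : Equiv.Perm (Fin n), eval (fun i => x (σ i)) f = eval x f := fun σ => by
    have := eval_of_mem_invariantForms hf σ 1 x
    simpa using this
  rw [← permMean_const (n := n) (eval x f)]
  simp only [← Finset.mul_sum]
  congr 1
  rw [← Finset.sum_congr rfl fun σ _ => h₂ σ]
  simp only [h₁]
  rw [Finset.sum_comm]
  exact Finset.sum_congr rfl fun k _ => Finset.sum_comm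

/-! ### Parity parts as forms in the squared variables -/

/-- List the variables with multiplicity. Index tuples replace exponent vectors so that parity parts
become linear or quadratic forms with indexed coefficients. -/
lemma exists_prod_pow_eq {n : ℕ} (e : ℕ) : ∀ b : Fin n → ℕ, ∑ i, b i = e →
    ∃ κ : Fin e → Fin n, ∀ y : Fin n → ℝ, ∏ i, y i ^ b i = ∏ s, y (κ s) := by
  induction e with
  | zero =>
    intro b hb
    refine ⟨Fin.elim0, fun y => ?_⟩
    have : ∀ i, b i = 0 := fun i => (Finset.sum_eq_zero_iff.1 hb) i (Finset.mem_univ i)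
    simp [this]
  | succ e ih =>
    intro b hb
    obtain ⟨k, hk⟩ : ∃ k, b k ≠ 0 := by
      by_contra hc
      push Not at hc
      simp [hc] at hb
    obtain ⟨κ, hκ⟩ := ih (Function.update b k (b k - 1)) (by
      have h₁ := Finset.sum_update_of_mem (Finset.mem_univ k) b (b k - 1)
      have h₂ := Finset.add_sum_erase Finset.univ b (Finset.mem_univ k)
      rw [Finset.sdiff_singleton_eq_erase] at h₁
      omega)
    refine ⟨Fin.cons k κ, fun y => ?_⟩
    rw [Fin.prod_univ_succ, Fin.cons_zero]
    simp only [Fin.cons_succ]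
    rw [← hκ y, ← Finset.mul_prod_erase _ _ (Finset.mem_univ k),
      ← Finset.mul_prod_erase Finset.univ (fun i => y i ^ Function.update b k (b k - 1) i)
        (Finset.mem_univ k), ← mul_assoc, Function.update_self, ← pow_succ',
      Nat.sub_add_cancel (Nat.one_le_iff_ne_zero.2 hk)]
    congr 1
    exact Finset.prod_congr rfl fun i hi => by
      rw [Function.update_of_ne (Finset.ne_of_mem_erase hi)]

/-- A monomial of degree `#S + 2 e` with odd support `S` is the product of the variables in `S` and
of `e` squares of variables. -/
lemma exists_prod_pow_eq_of_oddSupport {n e : ℕ} {a : Fin n →₀ ℕ} {S : Finset (Fin n)}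
    (hS : oddSupport a = S) (ha : a.degree = S.card + 2 * e) :
    ∃ κ : Fin e → Fin n, ∀ x : Fin n → ℝ,
      ∏ i, x i ^ a i = (∏ i ∈ S, x i) * ∏ s, x (κ s) ^ 2 := by
  have hmod : ∀ i, a i = (if i ∈ S then 1 else 0) + 2 * (a i / 2) := by
    intro i
    have : i ∈ S ↔ Odd (a i) := by simp [← hS, oddSupport]
    simp only [this, Nat.odd_iff]
    split_ifs <;> omega
  obtain ⟨κ, hκ⟩ := exists_prod_pow_eq e (fun i => a i / 2) (by
    rw [Finsupp.degree_eq_sum, Finset.sum_congr rfl fun i _ => hmod i, Finset.sum_add_distrib,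
      ← Finset.mul_sum, Finset.sum_boole, Finset.filter_mem_eq_inter, Finset.univ_inter] at ha
    simp only [Nat.cast_id] at ha
    omega)
  refine ⟨κ, fun x => ?_⟩
  rw [← hκ fun i => x i ^ 2, ← Finset.univ_inter S, ← Finset.prod_ite_mem,
    ← Finset.prod_mul_distrib]
  refine Finset.prod_congr rfl fun i _ => ?_
  conv_lhs => rw [hmod i]
  rw [pow_add, pow_mul]
  split_ifs <;> simp

lemma exists_degree_eq_card_oddSupport_add {n : ℕ} (a : Fin n →₀ ℕ) :
    ∃ e, a.degree = (oddSupport a).card + 2 * e := by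
  refine ⟨∑ i, a i / 2, ?_⟩
  rw [Finsupp.degree_eq_sum, oddSupport, Finset.card_filter, Finset.mul_sum,
    ← Finset.sum_add_distrib]
  refine Finset.sum_congr rfl fun i _ => ?_
  simp only [Nat.odd_iff]
  split_ifs <;> omega

lemma exists_parityPart_eq {n e : ℕ} [Nonempty (Fin n)] (q : MvPolynomial (Fin n) ℝ) (S : Finset (Fin n))
    (hq : ∀ a, coeff a q ≠ 0 → a.degree = S.card + 2 * e) :
    ∃ κ : (Fin n →₀ ℕ) → Fin e → Fin n, ∀ x, parityPart q S x =
      (∏ i ∈ S, x i) * ∑ a ∈ q.support with oddSupport a = S, coeff a q * ∏ s, x (κ a s) ^ 2 := by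
  have h : ∀ a : Fin n →₀ ℕ, ∃ κ : Fin e → Fin n, a ∈ q.support → oddSupport a = S →
      ∀ x : Fin n → ℝ, ∏ i, x i ^ a i = (∏ i ∈ S, x i) * ∏ s, x (κ s) ^ 2 := by
    intro a
    by_cases ha : a ∈ q.support ∧ oddSupport a = S
    · obtain ⟨κ, hκ⟩ := exists_prod_pow_eq_of_oddSupport ha.2 (hq a (mem_support_iff.1 ha.1))
      exact ⟨κ, fun _ _ => hκ⟩
    -- Monomials outside this parity part receive an arbitrary tuple, which is never used.
    · exact ⟨fun _ => Classical.arbitrary _, fun h₁ h₂ => absurd ⟨h₁, h₂⟩ ha⟩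
  choose κ hκ using h
  refine ⟨κ, fun x => ?_⟩
  rw [parityPart, Finset.mul_sum]
  refine Finset.sum_congr rfl fun a ha => ?_
  obtain ⟨h₁, h₂⟩ := Finset.mem_filter.1 ha
  rw [hκ a h₁ h₂]
  ring

/-- The permutation mean of the square of a parity part of a quartic form has a block
representation. -/
theorem isBlockFunction_parityPart {n : ℕ} (hn : 4 ≤ n) {q : MvPolynomial (Fin n) ℝ}
    (hq : ∀ a, coeff a q ≠ 0 → a.degree = 4) (S : Finset (Fin n)) :
    IsBlockFunction n fun x => ((n.factorial : ℝ))⁻¹ * ∑ σ : Equiv.Perm (Fin n),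
      parityPart q S (fun i => x (σ i)) ^ 2 := by
  have : Nonempty (Fin n) := ⟨⟨0, by omega⟩⟩
  by_cases hA : ∃ a ∈ q.support, oddSupport a = S
  · obtain ⟨a, ha, haS⟩ := hA
    -- One monomial of the part fixes $4=|S|+2e$, and this `e` then serves all of its monomials.
    obtain ⟨e, he⟩ := exists_degree_eq_card_oddSupport_add a
    rw [hq a (mem_support_iff.1 ha), haS] at he
    obtain ⟨κ, hκ⟩ := exists_parityPart_eq (e := e) q S fun b hb => (hq b hb).trans he
    generalize Finset.filter (fun a => oddSupport a = S) q.support = A at hκ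
    obtain rfl | rfl | rfl : e = 0 ∨ e = 1 ∨ e = 2 := by omega
    · have hS : S.card = 3 + 1 := by omega
      obtain ⟨i, T, hi, rfl, hT⟩ := Finset.card_eq_succ.1 hS
      obtain ⟨j, k, l, hjk, hjl, hkl, rfl⟩ := Finset.card_eq_three.1 hT
      simp only [Finset.mem_insert, Finset.mem_singleton, not_or] at hi
      obtain ⟨hij, hik, hil⟩ := hi
      have hp : ∀ x, parityPart q {i, j, k, l} x =
          (∑ a ∈ A, coeff a q) * (x i * x j * x k * x l) := fun x => by
        rw [hκ, Finset.prod_insert (by simp [hij, hik, hil]),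
          Finset.prod_insert (by simp [hjk, hjl]), Finset.prod_pair hkl]
        simp only [Finset.univ_eq_empty, Finset.prod_empty, mul_one]
        ring
      simp only [hp]
      exact isBlockFunction_quadruple hn hij hik hil hjk hjl hkl _
    · have hS : S.card = 2 := by omega
      obtain ⟨i, j, hij, rfl⟩ := Finset.card_eq_two.1 hS
      have hp : ∀ x, parityPart q {i, j} x =
          x i * x j * ∑ k, (∑ a ∈ A with κ a 0 = k, coeff a q) * x k ^ 2 := fun x => by
        rw [hκ, Finset.prod_pair hij, ← Finset.sum_fiberwise A fun a => κ a 0]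
        congr 1
        refine Finset.sum_congr rfl fun k _ => ?_
        rw [Finset.sum_mul]
        refine Finset.sum_congr rfl fun a ha => ?_
        rw [Fin.prod_univ_one, (Finset.mem_filter.1 ha).2]
      simp only [hp]
      exact isBlockFunction_pair hn hij _
    · have hS : S.card = 0 := by omega
      rw [Finset.card_eq_zero] at hS
      subst hS
      -- The ordering of the two indices in `κ a` is arbitrary, so `c` need not be symmetric; it is
      -- symmetrised below.
      let c : Fin n → Fin n → ℝ := fun k l => ∑ a ∈ A with (κ a 0, κ a 1) = (k, l), coeff a q
      have hp : ∀ x, parityPart q ∅ x =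
          ∑ k, ∑ l, (c k l + c l k) / 2 * (x k ^ 2 * x l ^ 2) := fun x => by
        obtain ⟨y, hy⟩ : ∃ y : Fin n → ℝ, ∀ i, x i ^ 2 = y i := ⟨_, fun _ => rfl⟩
        have h₁ : ∑ a ∈ A, coeff a q * ∏ s, y (κ a s) = ∑ k, ∑ l, c k l * (y k * y l) := by
          rw [← Finset.sum_fiberwise A fun a => (κ a 0, κ a 1), Fintype.sum_prod_type]
          refine Finset.sum_congr rfl fun k _ => Finset.sum_congr rfl fun l _ => ?_
          rw [Finset.sum_mul]
          refine Finset.sum_congr rfl fun a ha => ?_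
          have := (Finset.mem_filter.1 ha).2
          simp only [Prod.mk.injEq] at this
          rw [Fin.prod_univ_two, this.1, this.2]
        have h₂ : ∑ k, ∑ l, c l k * (y k * y l) = ∑ k, ∑ l, c k l * (y k * y l) := by
          rw [Finset.sum_comm]
          exact Finset.sum_congr rfl fun k _ => Finset.sum_congr rfl fun l _ => by ring
        have h₃ : ∑ k, ∑ l, (c k l + c l k) / 2 * (y k * y l) =
            ((∑ k, ∑ l, c k l * (y k * y l)) + ∑ k, ∑ l, c l k * (y k * y l)) / 2 := by
          simp only [← Finset.sum_add_distrib, Finset.sum_div]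
          exact Finset.sum_congr rfl fun k _ => Finset.sum_congr rfl fun l _ => by ring
        simp only [hκ, hy]
        rw [h₃, h₂, ← h₁, Finset.prod_empty, one_mul]
        ring
      simp only [hp]
      exact isBlockFunction_quadratic hn _ fun k l => by ring
  · have h : ∀ x, parityPart q S x = 0 := fun x => by
      rw [parityPart, Finset.filter_false_of_mem fun a ha haS => hA ⟨a, ha, haS⟩,
        Finset.sum_empty]
    simpa [h] using IsBlockFunction.zero n

/-- Every even symmetric octic that is a sum of squares has a block representation. -/
theorem hasBlockRepresentation_of_isSumSq {n : ℕ} (hn : 4 ≤ n) {f : MvPolynomial (Fin n) ℝ}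
    (hf : f ∈ invariantForms n 8) (hs : IsSumSq f) : HasBlockRepresentation n f := by
  obtain ⟨m, q, hq⟩ := exists_eq_sum_mul_self hs
  have hdeg : ∀ k a, coeff a (q k) ≠ 0 → a.degree = 4 := fun k a ha => by
    -- A single square is bounded by the whole sum, so no summand can have monomials of another
    -- degree.
    refine degree_eq_of_sq_le (d := 4) hf.1 (fun x => ?_) ha
    rw [hq, map_sum, sq, ← map_mul]
    exact Finset.single_le_sum (f := fun k => eval x (q k * q k))
      (fun i _ => by rw [map_mul]; exact mul_self_nonneg _) (Finset.mem_univ k)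
  obtain ⟨g, hg, hgf⟩ := IsBlockFunction.sum Finset.univ fun k _ =>
    IsBlockFunction.sum Finset.univ fun S _ => isBlockFunction_parityPart hn (hdeg k) S
  have : f = g := MvPolynomial.funext fun x => by rw [hgf, eval_eq_sum_permMean hf hq]
  rwa [this]

end EvenSymmetric

theorem mainTheorem9 (n : ℕ) (hn : 4 ≤ n) :
    (∀ f ∈ EvenSymmetric.invariantForms n 8,
      (f ∈ EvenSymmetric.sosForms n 8 ↔ EvenSymmetric.HasBlockRepresentation n f)) ∧
    EvenSymmetric.invariantSosForms n 8 =
      {f : MvPolynomial (Fin n) ℝ | EvenSymmetric.HasBlockRepresentation n f} := by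
  have h : ∀ f ∈ EvenSymmetric.invariantForms n 8,
      (f ∈ EvenSymmetric.sosForms n 8 ↔ EvenSymmetric.HasBlockRepresentation n f) := fun f hf =>
    ⟨fun hs => EvenSymmetric.hasBlockRepresentation_of_isSumSq hn hf hs.2,
      fun hb => ⟨hf.1, hb.isSumSq hn⟩⟩
  refine ⟨h, Set.ext fun f => ⟨fun hf => (h f hf.2).1 hf.1, fun hb => ?_⟩⟩
  have hf := EvenSymmetric.HasBlockRepresentation.mem_invariantForms hb
  exact ⟨(h f hf).2 hb, hf⟩
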